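/- Consider one-pass randomized streaming algorithms whose input is a stream describing an undirected simple graph $G=(V,E)$ on $V=\{0,\dots,n-1\}$, $n\ge 1$; the number $n$ is known in advance. In the \emph{insertion-only} model the stream is an arbitrarily ordered sequence of the edges of $G$, each occurring once. In the \emph{insertion-deletion} model the stream is a sequence, of any length, of insertions and deletions of edges such that at every moment the multiplicity of every edge (number of insertions minus number of deletions) is non-negative and at most $n^{a}$, where $a$ is a constant, and such that $E$ is the set of edges whose multiplicity is positive at the end. An algorithm is a single program, the same for all $n$, for a random access machine with fair coins, one-way access to the stream and a write-only output; its space is the maximum, over the whole execution, of the number of bits of its memory (including random bits that it keeps). Then there are semi-streaming algorithms for finding long paths in both models: (i) for every constant $c\in\mathbb N$ there are an algorithm and constants $C,k$ such that for every $n\ge 1$, every $n$-vertex graph $G$ and every insertion-only stream describing $G$, the algorithm terminates and uses at most $C\,n\,\ln^k(n+1)$ bits of space for every outcome of its coins, and with probability at least $1-n^{-c}$ it outputs a path of $G$ with at least $d/3$ edges, where $d=2|E|/n$ is the average degree of $G$; (ii) for all constants $c,a\in\mathbb N$ there are an algorithm and constants $C,k$ such that the same holds for every insertion-deletion stream describing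 $G$ with multiplicities at most $n^{a}$. -/

import Mathlib

open MeasureTheory

namespace LongPathStreaming

/-! ### Edge streams -/

/-- One element of an edge stream on the vertex set `{0, …, n - 1}`: the insertion
(`ins = true`) or the deletion (`ins = false`) of one copy of the undirected edge `{u, v}`.
The order in which the two endpoints are presented carries no meaning. -/
structure Update (n : ℕ) where
  ins : Bool
  u : Fin n
  v : Fin n

/-- The undirected edge that an update refers to. -/
def Update.edge {n : ℕ} (t : Update n) : Sym2 (Fin n) := s(t.u, t.v)

/-- `σ` is an insertion-only stream describing `G`: the edges of `G`, each inserted exactly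
once, in an arbitrary order. -/
def IsInsertionOnlyStream {n : ℕ} (G : SimpleGraph (Fin n)) (σ : List (Update n)) : Prop :=
  (∀ t ∈ σ, t.ins = true) ∧
    (σ.map Update.edge).Nodup ∧
    ∀ e, e ∈ σ.map Update.edge ↔ e ∈ G.edgeSet

/-- The multiplicity of the edge `e` after the updates `τ`:
the number of its insertions minus the number of its deletions. -/
def edgeMultiplicity {n : ℕ} (τ : List (Update n)) (e : Sym2 (Fin n)) : ℤ :=
  (τ.countP fun t => t.ins = true ∧ t.edge = e : ℕ) -
    (τ.countP fun t => t.ins = false ∧ t.edge = e : ℕ)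

/-- `σ` is an insertion-deletion stream describing `G`, with multiplicities bounded by `B`:
at every moment the multiplicity of every edge is at least `0` and at most `B`, and the edges
that survive at the end are those of `G`. The number of updates is not bounded. -/
def IsInsertionDeletionStream {n : ℕ} (B : ℕ) (G : SimpleGraph (Fin n))
    (σ : List (Update n)) : Prop :=
  (∀ t ∈ σ, t.u ≠ t.v) ∧
    (∀ τ, τ <+: σ → ∀ e, 0 ≤ edgeMultiplicity τ e ∧ edgeMultiplicity τ e ≤ B) ∧
    ∀ e, e ∈ G.edgeSet ↔ 0 < edgeMultiplicity σ e

/-! ### Paths -/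

/-- The average degree `2 |E| / n`. -/
noncomputable def averageDegree {n : ℕ} (G : SimpleGraph (Fin n)) : ℝ :=
  2 * (G.edgeSet.ncard : ℝ) / n

/-- `out` is the list of the vertices, in order, of a path in `G` with at least `ℓ` edges. -/
def IsPathOfLengthAtLeast {n : ℕ} (G : SimpleGraph (Fin n)) (ℓ : ℝ) (out : List ℕ) : Prop :=
  ∃ (u v : Fin n) (p : G.Walk u v),
    p.IsPath ∧ p.support.map Fin.val = out ∧ ℓ ≤ (p.length : ℝ)

/-! ### One-pass randomized streaming algorithms

The machine is a random access machine with fair coins and arithmetic on natural numbers.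
It reads the stream once, from left to right, and writes its answer on a write-only output.
A program is a fixed finite object, the same for all `n`. -/

/-- The memory: one natural number per register, almost all of them `0`. -/
abbrev Mem : Type := ℕ →₀ ℕ

/-- The number of bits of the memory: for each nonzero register, the length in binary of its
address and of its content. -/
def Mem.bits (m : Mem) : ℕ := m.sum fun a x => a.size + x.size

/-- Arithmetic expressions; `get a` is the content of the register whose address is the value
of `a` (indirect addressing). A fixed expression can be evaluated in space linear in the size
of the memory. -/
inductive Arith : Type
  | const (k : ℕ)
  | get (a : Arith)
  | add (x y : Arith)
  | sub (x y : Arith)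
  | mul (x y : Arith)
  | div (x y : Arith)
  | mod (x y : Arith)

/-- The value of an expression (`sub` is truncated at `0`). -/
def Arith.eval (m : Mem) : Arith → ℕ
  | .const k => k
  | .get a => m (a.eval m)
  | .add x y => x.eval m + y.eval m
  | .sub x y => x.eval m - y.eval m
  | .mul x y => x.eval m * y.eval m
  | .div x y => x.eval m / y.eval m
  | .mod x y => x.eval m % y.eval m

/-- Programs. -/
inductive Program : Type
  /-- do nothing -/
  | skip
  /-- run one program after the other -/
  | seq (p q : Program)
  /-- branch on whether the value of `x` is nonzero -/
  | ite (x : Arith) (p q : Program)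
  /-- repeat `p` as long as the value of `x` is nonzero -/
  | loop (x : Arith) (p : Program)
  /-- store the value of `x` in the register with address `a` -/
  | set (a x : Arith)
  /-- store a fresh fair random bit in the register with address `a` -/
  | flip (a : Arith)
  /-- consume the next update of the stream: store its kind in the register with address `k`
  (`1` for an insertion, `2` for a deletion, `0` if the stream is exhausted), then its
  endpoints in the registers with addresses `u` and `v` -/
  | next (k u v : Arith)
  /-- append the value of `x` to the output -/
  | emit (x : Arith)

/-- The configuration of the machine (apart from the control): the memory, the part of the
stream not yet read, the coins not yet flipped, the output so far, and the largest number of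
bits that the memory has had so far. -/
structure Config (n : ℕ) where
  mem : Mem
  input : List (Update n)
  coins : ℕ → Bool
  output : List ℕ
  peak : ℕ

/-- Write `x` into the register `a`, and record the number of bits now in use. -/
noncomputable def Config.write {n : ℕ} (s : Config n) (a x : ℕ) : Config n :=
  { s with
    mem := s.mem.update a x
    peak := max s.peak (Mem.bits (s.mem.update a x)) }

/-- The effect of `Program.flip`, for an evaluated address. -/
noncomputable def Config.flip {n : ℕ} (s : Config n) (a : ℕ) : Config n :=
  ({ s with coins := fun i => s.coins (i + 1) } : Config n).write a (s.coins 0).toNat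

/-- The effect of `Program.next`, for evaluated addresses. -/
noncomputable def Config.next {n : ℕ} (s : Config n) (k u v : ℕ) : Config n :=
  match s.input with
  | [] => ((s.write k 0).write u 0).write v 0
  | t :: σ =>
    ((({ s with input := σ } : Config n).write k (if t.ins then 1 else 2)).write u t.u).write v t.v

/-- `Exec p s s'`: started in `s`, the program `p` terminates in `s'`. -/
inductive Exec {n : ℕ} : Program → Config n → Config n → Prop
  | skip (s) : Exec .skip s s
  | seq {p q s₁ s₂ s₃} : Exec p s₁ s₂ → Exec q s₂ s₃ → Exec (.seq p q) s₁ s₃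
  | ite_true {x p q s s'} : x.eval s.mem ≠ 0 → Exec p s s' → Exec (.ite x p q) s s'
  | ite_false {x p q s s'} : x.eval s.mem = 0 → Exec q s s' → Exec (.ite x p q) s s'
  | loop_done {x p s} : x.eval s.mem = 0 → Exec (.loop x p) s s
  | loop_step {x p s₁ s₂ s₃} : x.eval s₁.mem ≠ 0 → Exec p s₁ s₂ → Exec (.loop x p) s₂ s₃ →
      Exec (.loop x p) s₁ s₃
  | set (a x s) : Exec (.set a x) s (s.write (a.eval s.mem) (x.eval s.mem))
  | flip (a s) : Exec (.flip a) s (s.flip (a.eval s.mem))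
  | next (k u v s) :
      Exec (.next k u v) s (s.next (k.eval s.mem) (u.eval s.mem) (v.eval s.mem))
  | emit (x s) : Exec (.emit x) s { s with output := s.output ++ [x.eval s.mem] }

/-- The initial configuration: register `0` holds the number `n` of vertices, the stream and
the coins are untouched, and nothing has been written. -/
noncomputable def initial {n : ℕ} (σ : List (Update n)) (ω : ℕ → Bool) : Config n where
  mem := Finsupp.single 0 n
  input := σ
  coins := ω
  output := []
  peak := Mem.bits (Finsupp.single 0 n)

/-- The law of an infinite sequence of independent fair coins. -/
noncomputable def coinMeasure : Measure (ℕ → Bool) :=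
  Measure.infinitePi fun _ => (PMF.uniformOfFintype Bool).toMeasure

/-- On the stream `σ`, the program `P` terminates whatever the coins show, and never has more
than `b` bits in its memory. -/
def RunsInSpace {n : ℕ} (P : Program) (σ : List (Update n)) (b : ℝ) : Prop :=
  ∀ ω, ∃ s, Exec P (initial σ ω) s ∧ (s.peak : ℝ) ≤ b

/-- The probability, over the coins, that the output of `P` on the stream `σ` satisfies `Q`. -/
noncomputable def outputProb {n : ℕ} (P : Program) (σ : List (Update n))
    (Q : List ℕ → Prop) : ℝ :=
  coinMeasure.real {ω | ∃ s, Exec P (initial σ ω) s ∧ Q s.output}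

/-- There is a semi-streaming algorithm, i.e. one with space `O(n polylog n)`, that on every
stream `σ` which describes an `n`-vertex graph `G` in the sense of `Describes` outputs,
with probability at least `1 - n ^ (-c)`, a path in `G` of length at least one third of the
average degree of `G`. -/
def ExistsSemiStreamingAlgorithm (c : ℕ)
    (Describes : ∀ n : ℕ, SimpleGraph (Fin n) → List (Update n) → Prop) : Prop :=
  ∃ (P : Program) (C : ℝ) (k : ℕ), ∀ n : ℕ, 1 ≤ n →
    ∀ (G : SimpleGraph (Fin n)) (σ : List (Update n)), Describes n G σ →
      RunsInSpace P σ (C * n * Real.log (n + 1) ^ k) ∧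
      1 - 1 / (n : ℝ) ^ c ≤
        outputProb P σ (IsPathOfLengthAtLeast G (averageDegree G / 3))

end LongPathStreaming

/-!
One algorithm serves both models, since an insertion-only stream is an insertion-deletion stream
with multiplicities at most `1`. It keeps `K = O(n log² n)` independent samplers of the edges that
are present at the end of the stream, and outputs a longest path of the graph `H` formed by the
edges that the samplers reveal. All of `H` being edges of `G`, only the length is at stake.

*Why `H` has a long path.* If no path of `H` has more than `ℓ` edges, then a depth-first search
forest of `H` has depth at most `ℓ`, so all edges of `H` join a vertex to one of its `ℓ` nearest
ancestors (`exists_edgeSet_subset_ancestorPairs`). A parent function `f` covers at most `n ℓ` pairs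
in this way; if `ℓ < d / 3`, these are fewer than two thirds of the edges of `G`, and the samplers
have missed the remaining set `X` of edges. For a fixed `f` this is very unlikely, and there are
only `n ^ n` functions `f` for the union bound.

*The samplers.* A sampler keeps the edges whose value under a random affine hash function modulo a
power of two is below a threshold; the thresholds run through all rates `2 ^ (-j)`. At a rate
between `1 / (16 |E|)` and `1 / (8 |E|)` a seed isolates an edge of `X` with probability at least `1 / 96`
(`card_isolating_seeds`); this needs the joint distribution of two hash values only up to a
constant factor (`card_progression_mod_lt`). With `O(n log n)` samplers of this rate all
sets `X` are hit with probability at least `1 - n ^ (-c)` (`card_seeds_missing_le`,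
`card_badSeeds_mul_le`).

*The sketch.* A sampler maintains `∑ x_e`, `∑ x_e e` and `∑ x_e e ^ 2` over the edges `e` that it
keeps, `x_e` being the multiplicity. As `x_e ≥ 0`, these moments are those of a multiple of a single
`e` if and only if `∑ x_f (f - e) ^ 2 = 0`, so an isolated edge is recognized without any error
(`pos_of_detects`, `detects_of_forall`). All moments of all samplers are the digits of one number.

*The machine.* Time being unlimited, arrays are stored as the digits of big numbers in a fixed set of
registers, and a longest path is found by exhaustive search. Programs are verified with a
total-correctness calculus (`Ensures`) that carries the space bound along.
-/

namespace LongPathStreaming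

/-! ### Depth-first search forests -/

section DepthFirstSearch

variable {V : Type*} {H : SimpleGraph V}

/-- `x` descends from `y` in the forest with parent function `g`, along a path of `H`.
The number of steps is the length of that path, hence at most the length of a longest path. -/
def Descends (H : SimpleGraph V) (g : V → V) (x y : V) : Prop :=
  ∃ p : H.Walk y x, p.IsPath ∧ g^[p.length] x = y

/-- The part of a depth-first search that starts at `v` while `T` is the set of unvisited
vertices: it visits a set `D ⊆ T`, which has no edge to the rest of `T`, and all edges inside
`D ∪ {v}` join a vertex to one of its ancestors. The parent function `f` matters on `D` only;
stating the conclusion for all `g` that agree with `f` there lets us glue trees together. -/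
lemma exists_dfs_tree [DecidableEq V] (T : Finset V) : ∀ v ∉ T, ∃ D ⊆ T, ∃ f : V → V,
    (∀ x ∈ insert v D, ∀ y ∈ T \ D, ¬ H.Adj x y) ∧
    ∀ g : V → V, (∀ u ∈ D, g u = f u) →
      (∀ u ∈ insert v D, ∃ p : H.Walk v u, p.IsPath ∧ (∀ w ∈ p.support, w ∈ insert v D) ∧
        g^[p.length] u = v) ∧
      ∀ x ∈ insert v D, ∀ y ∈ insert v D, H.Adj x y → Descends H g x y ∨ Descends H g y x := by
  induction T using Finset.strongInduction with
  | H T ih =>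
  intro v hv
  by_cases hw : ∃ w ∈ T, H.Adj v w
  · obtain ⟨w, hwT, hvw⟩ := hw
    obtain ⟨D₁, hD₁, f₁, hn₁, hg₁⟩ := ih (T.erase w) (Finset.erase_ssubset hwT) w (by simp)
    have hss : T.erase w \ D₁ ⊂ T :=
      Finset.ssubset_of_subset_of_ssubset Finset.sdiff_subset (Finset.erase_ssubset hwT)
    obtain ⟨D₂, hD₂, f₂, hn₂, hg₂⟩ := ih _ hss v (fun h => hv (hss.1 h))
    have h1 : ∀ x ∈ D₁, x ∈ T ∧ x ≠ w := fun x hx => by simpa [and_comm] using hD₁ hx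
    have h2 : ∀ x ∈ D₂, x ∈ T ∧ x ≠ w ∧ x ∉ D₁ := fun x hx => by
      have := hD₂ hx
      simp only [Finset.mem_sdiff, Finset.mem_erase] at this
      tauto
    refine ⟨insert w (D₁ ∪ D₂), ?_, fun u => if u ∈ D₁ then f₁ u else if u ∈ D₂ then f₂ u else v,
      ?_, ?_⟩
    · intro x hx
      simp only [Finset.mem_insert, Finset.mem_union] at hx
      rcases hx with rfl | hx | hx
      · exact hwT
      · exact (h1 x hx).1
      · exact (h2 x hx).1
    · intro x hx y hy
      simp only [Finset.mem_insert, Finset.mem_union, Finset.mem_sdiff, not_or] at hx hy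
      have hy1 : y ∈ T.erase w \ D₁ := by simp; tauto
      have hy2 : y ∈ (T.erase w \ D₁) \ D₂ := by
        rw [Finset.mem_sdiff]; exact ⟨hy1, hy.2.2.2⟩
      rcases hx with rfl | rfl | hx | hx
      · exact hn₂ _ (by simp) _ hy2
      · exact hn₁ _ (by simp) _ hy1
      · exact hn₁ _ (by simp [hx]) _ hy1
      · exact hn₂ _ (by simp [hx]) _ hy2
    · intro g hg
      beta_reduce at hg
      have hgw : g w = v := by
        rw [hg w (by simp), if_neg fun h => (h1 w h).2 rfl, if_neg fun h => (h2 w h).2.1 rfl]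
      obtain ⟨hp₁, he₁⟩ := hg₁ g fun u hu => by rw [hg u (by simp [hu]), if_pos hu]
      obtain ⟨hp₂, he₂⟩ := hg₂ g fun u hu => by
        rw [hg u (by simp [hu]), if_neg (h2 u hu).2.2, if_pos hu]
      have key : ∀ u ∈ insert w D₁, ∃ p : H.Walk v u, p.IsPath ∧
          (∀ z ∈ p.support, z ∈ insert v (insert w (D₁ ∪ D₂))) ∧ g^[p.length] u = v := by
        intro u hu
        obtain ⟨p, hp, hs, hl⟩ := hp₁ u hu
        refine ⟨.cons hvw p, ?_, ?_, ?_⟩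
        · rw [SimpleGraph.Walk.cons_isPath_iff]
          refine ⟨hp, fun h => hv ?_⟩
          have := hs v h
          rw [Finset.mem_insert] at this
          rcases this with rfl | h'
          · exact hwT
          · exact (h1 v h').1
        · intro z hz
          simp only [SimpleGraph.Walk.support_cons, List.mem_cons] at hz
          rcases hz with rfl | hz
          · simp
          · have := hs z hz
            simp only [Finset.mem_insert, Finset.mem_union] at this ⊢
            tauto
        · rw [SimpleGraph.Walk.length_cons, Function.iterate_succ_apply', hl, hgw]
      have split : ∀ u ∈ insert v (insert w (D₁ ∪ D₂)), u ∈ insert w D₁ ∨ u ∈ insert v D₂ := by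
        intro u hu
        simp only [Finset.mem_insert, Finset.mem_union] at hu ⊢
        tauto
      have cross : ∀ x ∈ insert w D₁, ∀ y ∈ insert v D₂, H.Adj x y → Descends H g x y := by
        intro x hx y hy hxy
        rw [Finset.mem_insert] at hy
        rcases hy with rfl | hy
        · obtain ⟨p, hp, -, hl⟩ := key x hx
          exact ⟨p, hp, hl⟩
        · exact absurd hxy (hn₁ x hx y (hD₂ hy))
      refine ⟨fun u hu => ?_, fun x hx y hy hxy => ?_⟩
      · rcases split u hu with hu | hu
        · exact key u hu
        · obtain ⟨p, hp, hs, hl⟩ := hp₂ u hu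
          refine ⟨p, hp, fun z hz => ?_, hl⟩
          have := hs z hz
          simp only [Finset.mem_insert, Finset.mem_union] at this ⊢
          tauto
      · rcases split x hx with hx | hx <;> rcases split y hy with hy | hy
        · exact he₁ x hx y hy hxy
        · exact .inl (cross x hx y hy hxy)
        · exact .inr (cross y hy x hx hxy.symm)
        · exact he₂ x hx y hy hxy
  · push Not at hw
    refine ⟨∅, by simp, id, by simpa using hw, fun g _ => ⟨?_, ?_⟩⟩
    · intro u hu
      obtain rfl : u = v := by simpa using hu
      exact ⟨.nil, by simp⟩
    · intro x hx y hy hxy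
      obtain rfl : x = v := by simpa using hx
      obtain rfl : y = x := by simpa using hy
      exact absurd hxy (H.loopless.irrefl _)

/-- Every finite graph has a depth-first search forest: all its edges join a vertex to one of
its ancestors. -/
lemma exists_dfs_forest [DecidableEq V] (T : Finset V) : ∃ f : V → V,
    ∀ g : V → V, (∀ u ∈ T, g u = f u) →
      ∀ x ∈ T, ∀ y ∈ T, H.Adj x y → Descends H g x y ∨ Descends H g y x := by
  induction T using Finset.strongInduction with
  | H T ih =>
  rcases T.eq_empty_or_nonempty with rfl | ⟨v, hv⟩
  · exact ⟨id, by simp⟩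
  obtain ⟨D, hD, f, hn, hg⟩ := exists_dfs_tree (H := H) (T.erase v) v (by simp)
  have hss : T.erase v \ D ⊂ T :=
    Finset.ssubset_of_subset_of_ssubset Finset.sdiff_subset (Finset.erase_ssubset hv)
  obtain ⟨f', hf'⟩ := ih _ hss
  refine ⟨fun u => if u ∈ D then f u else f' u, fun g hgf => ?_⟩
  beta_reduce at hgf
  obtain ⟨-, he⟩ := hg g fun u hu => by
    rw [hgf u (Finset.mem_of_mem_erase (hD hu)), if_pos hu]
  have he' := hf' g fun u hu => by
    rw [hgf u (hss.1 hu), if_neg (Finset.mem_sdiff.1 hu).2]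
  have split : ∀ u ∈ T, u ∈ insert v D ∨ u ∈ T.erase v \ D := by
    intro u hu
    simp only [Finset.mem_insert, Finset.mem_sdiff, Finset.mem_erase]
    tauto
  intro x hx y hy hxy
  rcases split x hx with hx | hx <;> rcases split y hy with hy | hy
  · exact he x hx y hy hxy
  · exact absurd hxy (hn x hx y hy)
  · exact absurd hxy.symm (hn y hy x hx)
  · exact he' x hx y hy hxy

/-- The pairs `{x, f^i x}` with `1 ≤ i ≤ ℓ`: the edges that a forest with parent function `f`
and depth at most `ℓ` can cover. -/
def ancestorPairs [DecidableEq V] [Fintype V] (f : V → V) (ℓ : ℕ) : Finset (Sym2 V) :=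
  Finset.image (fun xi : V × ℕ => s(xi.1, f^[xi.2] xi.1)) (Finset.univ ×ˢ Finset.Icc 1 ℓ)

lemma card_ancestorPairs_le [DecidableEq V] [Fintype V] (f : V → V) (ℓ : ℕ) :
    (ancestorPairs f ℓ).card ≤ Fintype.card V * ℓ := by
  refine Finset.card_image_le.trans ?_
  simp [Finset.card_product]

/-- The edges of a graph without paths longer than `ℓ` are the ancestor pairs of one of the
at most `|V| ^ |V|` parent functions. -/
lemma exists_edgeSet_subset_ancestorPairs [DecidableEq V] [Fintype V] (H : SimpleGraph V) (ℓ : ℕ)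
    (h : ∀ (u v : V) (p : H.Walk u v), p.IsPath → p.length ≤ ℓ) :
    ∃ f : V → V, ∀ e ∈ H.edgeSet, e ∈ ancestorPairs f ℓ := by
  obtain ⟨f, hf⟩ := exists_dfs_forest (H := H) Finset.univ
  have main : ∀ x y, H.Adj x y → Descends H f x y → s(x, y) ∈ ancestorPairs f ℓ := by
    rintro x y hxy ⟨p, hp, hl⟩
    refine Finset.mem_image.2 ⟨(x, p.length), ?_, by rw [hl]⟩
    have h0 : p.length ≠ 0 := fun h0 => hxy.ne' (SimpleGraph.Walk.eq_of_length_eq_zero h0)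
    have := h _ _ p hp
    simp
    omega
  refine ⟨f, fun e => ?_⟩
  induction e using Sym2.ind with
  | _ x y =>
  intro hxy
  rw [SimpleGraph.mem_edgeSet] at hxy
  rcases hf f (fun _ _ => rfl) x (Finset.mem_univ _) y (Finset.mem_univ _) hxy with h' | h'
  · exact main x y hxy h'
  · rw [Sym2.eq_swap]
    exact main y x hxy.symm h'

end DepthFirstSearch

/-! ### Isolating an edge with a random affine hash function -/

section Isolation

/-- The residues of `A + r d` for `r < M` are spread evenly enough: between two wraps modulo `M`,
of which there are at most `d`, the progression has at most `T / d + 1` terms below `T`. -/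
lemma card_progression_mod_lt {M T d A : ℕ} (hd : 0 < d) (hA : A < M) :
    ((Finset.range M).filter fun r => (A + r * d) % M < T).card ≤ (d + 1) * (T / d + 1) := by
  have hM : 0 < M := by omega
  have key : ((Finset.range M).filter fun r => (A + r * d) % M < T).card ≤
      (Finset.range (d + 1) ×ˢ Finset.range (T / d + 1)).card := by
    refine Finset.card_le_card_of_injOn (fun r => ((A + r * d) / M, (A + r * d) % M / d)) ?_ ?_
    · intro r hr
      simp only [Finset.coe_filter, Finset.mem_range, Set.mem_ofPred_eq] at hr
      simp only [Finset.coe_product, Finset.coe_range, Set.mem_prod, Set.mem_Iio]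
      refine ⟨?_, Nat.lt_succ_of_le (Nat.div_le_div_right hr.2.le)⟩
      rw [Nat.div_lt_iff_lt_mul hM]
      have : r * d ≤ M * d := Nat.mul_le_mul_right d hr.1.le
      nlinarith
    · have aux : ∀ r r', r < r' → (A + r * d) / M = (A + r' * d) / M →
          (A + r * d) % M / d ≠ (A + r' * d) % M / d := by
        intro r r' hlt hq hm
        have h1 := Nat.div_add_mod (A + r * d) M
        have h2 := Nat.div_add_mod (A + r' * d) M
        have h3 : r * d + d ≤ r' * d := by nlinarith
        rw [hq] at h1
        have h4 : (A + r * d) % M + d ≤ (A + r' * d) % M := by omega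
        have h5 := Nat.div_le_div_right (c := d) h4
        rw [Nat.add_div_right _ hd] at h5
        omega
      intro r _ r' _ h
      simp only [Prod.mk.injEq] at h
      rcases lt_trichotomy r r' with hlt | heq | hlt
      · exact absurd h.2 (aux r r' hlt h.1)
      · exact heq
      · exact absurd h.2.symm (aux r' r hlt h.1.symm)
  simpa using key

/-- The pairs `(r, s)` of coefficients for which both `e` and `f` hash below `T`. -/
def collisions (M T e f : ℕ) : Finset (ℕ × ℕ) :=
  (Finset.range M ×ˢ Finset.range M).filter fun a =>
    (a.1 * e + a.2) % M < T ∧ (a.1 * f + a.2) % M < T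

lemma card_collisions_le_of_lt {M T e f : ℕ} (hef : e < f) (hT : f - e ≤ T) (hTM : T ≤ M) :
    (collisions M T e f).card ≤ 4 * T * T := by
  obtain ⟨d, rfl⟩ : ∃ d, f = e + d := ⟨f - e, by omega⟩
  have hd : 0 < d := by omega
  have hdT : d ≤ T := by omega
  have h4 : (d + 1) * (T / d + 1) ≤ 4 * T := by
    have h1 : d * (T / d) ≤ T := Nat.mul_div_le T d
    have h2 : 1 ≤ T / d := Nat.div_pos hdT hd
    nlinarith
  have := Finset.card_le_mul_card_image_of_maps_to (s := collisions M T e (e + d))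
    (t := Finset.range T) (f := fun a => (a.1 * e + a.2) % M)
    (fun a ha => by
      simp only [collisions, Finset.mem_filter] at ha
      simpa using ha.2.1) (4 * T) ?_
  · simpa using this
  intro A hA
  have hAM : A < M := (Finset.mem_range.1 hA).trans_le hTM
  refine le_trans ?_ ((card_progression_mod_lt (T := T) hd hAM).trans h4)
  refine Finset.card_le_card_of_injOn Prod.fst ?_ ?_
  · intro a ha
    simp only [collisions, Finset.coe_filter, Finset.mem_filter, Finset.mem_product,
      Finset.mem_range, Set.mem_ofPred_eq] at ha ⊢
    obtain ⟨⟨⟨h1, -⟩, -, h2⟩, h3⟩ := ha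
    refine ⟨h1, ?_⟩
    rw [← h3, Nat.mod_add_mod]
    convert h2 using 2
    ring
  · intro a ha b hb hab
    simp only [collisions, Finset.coe_filter, Finset.mem_filter, Finset.mem_product,
      Finset.mem_range, Set.mem_ofPred_eq] at ha hb
    refine Prod.ext hab ?_
    have h3 : a.1 * e + a.2 ≡ a.1 * e + b.2 [MOD M] := by
      have := ha.2.trans hb.2.symm
      rwa [← hab] at this
    have := Nat.ModEq.add_left_cancel' _ h3
    exact Nat.ModEq.eq_of_lt_of_lt this ha.1.1.2 hb.1.1.2

lemma card_collisions_le {M T e f : ℕ} (hef : e ≠ f) (he : e ≤ T) (hf : f ≤ T) (hTM : T ≤ M) :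
    (collisions M T e f).card ≤ 4 * T * T := by
  rcases lt_or_gt_of_ne hef with h | h
  · exact card_collisions_le_of_lt h (by omega) hTM
  · have : collisions M T e f = collisions M T f e := by
      simp only [collisions, and_comm]
    rw [this]
    exact card_collisions_le_of_lt h (by omega) hTM

lemma card_add_mod_lt {M T : ℕ} (c : ℕ) (hTM : T ≤ M) :
    ((Finset.range M).filter fun s => (c + s) % M < T).card = T := by
  have h := Nat.filter_Ico_card_eq_of_periodic c M (fun x => x % M < T) (fun x => by simp)
  have h2 : M.count (fun x => x % M < T) = T := by
    rw [Nat.count_eq_card_filter_range]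
    have : (Finset.range M).filter (fun x => x % M < T) = Finset.range T := by
      ext x
      simp only [Finset.mem_filter, Finset.mem_range]
      refine ⟨fun ⟨h1, h2⟩ => by rwa [Nat.mod_eq_of_lt h1] at h2, fun h => ?_⟩
      exact ⟨h.trans_le hTM, by rwa [Nat.mod_eq_of_lt (h.trans_le hTM)]⟩
    rw [this, Finset.card_range]
  refine Eq.trans ?_ (h.trans h2)
  refine Finset.card_bij (fun s _ => c + s) ?_ ?_ ?_
  · intro s hs
    simp only [Finset.mem_filter, Finset.mem_range, Finset.mem_Ico] at hs ⊢
    exact ⟨by omega, hs.2⟩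
  · intro a _ b _ hab
    omega
  · intro b hb
    simp only [Finset.mem_filter, Finset.mem_Ico] at hb
    refine ⟨b - c, ?_, by omega⟩
    simp only [Finset.mem_filter, Finset.mem_range]
    exact ⟨by omega, by rw [show c + (b - c) = b by omega]; exact hb.2⟩

/-- The key `e` hashes below `T` under the function `e ↦ r e + s mod M`, where the seed
`y = r M + s` encodes both coefficients. Only `y` modulo `M ^ 2` matters. -/
def Kept (M T y e : ℕ) : Prop := (y / M * e + y) % M < T

instance (M T y e : ℕ) : Decidable (Kept M T y e) :=
  inferInstanceAs (Decidable (_ < _))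

/-- Among the keys in `E`, the seed `y` keeps `e` and no other. -/
def Isolates (M T : ℕ) (E : Finset ℕ) (y e : ℕ) : Prop :=
  Kept M T y e ∧ ∀ f ∈ E, Kept M T y f → f = e

instance (M T : ℕ) (E : Finset ℕ) (y e : ℕ) : Decidable (Isolates M T E y e) :=
  inferInstanceAs (Decidable (_ ∧ _))

lemma kept_mod_sq {M : ℕ} (T y e : ℕ) : Kept M T (y % M ^ 2) e ↔ Kept M T y e := by
  rcases Nat.eq_zero_or_pos M with rfl | hM
  · simp
  have h : y % M ^ 2 / M * e + y % M ^ 2 ≡ y / M * e + y [MOD M] := by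
    have h1 : y % M ^ 2 ≡ y [MOD M] := by
      rw [Nat.ModEq, Nat.mod_mod_of_dvd _ (Dvd.intro_left M (by ring))]
    have h2 : y % M ^ 2 / M ≡ y / M [MOD M] := by
      rw [pow_two, Nat.mod_mul_right_div_self]
      exact Nat.mod_modEq _ _
    exact (h2.mul_right e).add h1
  unfold Kept
  rw [h]

lemma kept_mul_add {M r s : ℕ} (T e : ℕ) (hs : s < M) :
    Kept M T (r * M + s) e ↔ (r * e + s) % M < T := by
  unfold Kept
  have h1 : (r * M + s) / M = r := by
    rw [mul_comm, Nat.mul_add_div (by omega), Nat.div_eq_of_lt hs, add_zero]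
  rw [h1, show r * e + (r * M + s) = r * e + s + M * r by ring, Nat.add_mul_mod_self_left]

/-- If the sampling rate `T / M` is at most `1 / (8 |E|)`, then a random seed isolates each
`e ∈ E` with probability at least half the rate; these events are disjoint for different `e`.
-/
lemma card_isolating_seeds {M T : ℕ} {E X : Finset ℕ} (hXE : X ⊆ E) (hE : ∀ e ∈ E, e ≤ T)
    (hTM : T ≤ M) (h8 : 8 * E.card * T ≤ M) :
    X.card * (M * T) ≤
      2 * ((Finset.range (M ^ 2)).filter fun y => ∃ e ∈ X, Isolates M T E y e).card := by
  classical
  let S := Finset.range M ×ˢ Finset.range M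
  let kp : ℕ → Finset (ℕ × ℕ) := fun e => S.filter fun a => (a.1 * e + a.2) % M < T
  have hkp : ∀ e, (kp e).card = M * T := by
    intro e
    have := Finset.card_eq_sum_card_fiberwise (s := kp e) (t := Finset.range M) (f := Prod.fst)
      (fun a ha => by simp [kp, S] at ha; simpa using ha.1.1)
    rw [this]
    rw [Finset.sum_congr rfl (g := fun _ => T), Finset.sum_const, Finset.card_range, smul_eq_mul]
    intro r hr
    rw [← card_add_mod_lt (r * e) hTM]
    refine Finset.card_bij' (fun a _ => a.2) (fun s _ => (r, s)) ?_ ?_ ?_ ?_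
    · intro a ha
      simp only [kp, S, Finset.mem_filter, Finset.mem_product, Finset.mem_range] at ha ⊢
      rw [← ha.2]
      exact ⟨ha.1.1.2, ha.1.2⟩
    · intro s hs
      simp only [kp, S, Finset.mem_filter, Finset.mem_product, Finset.mem_range] at hs hr ⊢
      exact ⟨⟨⟨hr, hs.1⟩, hs.2⟩, trivial⟩
    · intro a ha
      simp only [Finset.mem_filter] at ha
      rw [← ha.2]
    · intro s _
      rfl
  let iso : ℕ → Finset (ℕ × ℕ) := fun e =>
    S.filter fun a => (a.1 * e + a.2) % M < T ∧ ∀ f ∈ E, (a.1 * f + a.2) % M < T → f = e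
  have hiso : ∀ e ∈ X, M * T ≤ 2 * (iso e).card := by
    intro e he
    have hsub : kp e ⊆ iso e ∪ (E.erase e).biUnion fun f => collisions M T e f := by
      intro a ha
      simp only [kp, iso, Finset.mem_filter, Finset.mem_union, Finset.mem_biUnion,
        Finset.mem_erase, collisions] at ha ⊢
      by_cases h : ∀ f ∈ E, (a.1 * f + a.2) % M < T → f = e
      · exact .inl ⟨ha.1, ha.2, h⟩
      · push Not at h
        obtain ⟨f, hf, h1, h2⟩ := h
        exact .inr ⟨f, ⟨h2, hf⟩, ha.1, ha.2, h1⟩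
    have h1 := (Finset.card_le_card hsub).trans (Finset.card_union_le _ _)
    have h2 : ((E.erase e).biUnion fun f => collisions M T e f).card ≤ E.card * (4 * T * T) := by
      refine Finset.card_biUnion_le.trans ?_
      refine (Finset.sum_le_card_nsmul _ _ (4 * T * T) fun f hf => ?_).trans ?_
      · rw [Finset.mem_erase] at hf
        exact card_collisions_le hf.1.symm (hE e (hXE he)) (hE f hf.2) hTM
      · rw [smul_eq_mul]
        exact Nat.mul_le_mul_right _ (Finset.card_le_card (Finset.erase_subset _ _))
    rw [hkp e] at h1
    have h3 : 8 * E.card * T * T ≤ M * T := Nat.mul_le_mul_right T h8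
    have h4 : 2 * (E.card * (4 * T * T)) = 8 * E.card * T * T := by ring
    omega
  have hdisj : (X.biUnion iso).card = ∑ e ∈ X, (iso e).card := by
    refine Finset.card_biUnion fun e he f hf hef => ?_
    refine Finset.disjoint_left.2 ?_
    intro a ha hb
    simp only [iso, Finset.mem_filter] at ha hb
    exact hef (hb.2.2 e (hXE he) ha.2.1)
  have hinj : (X.biUnion iso).card ≤
      ((Finset.range (M ^ 2)).filter fun y => ∃ e ∈ X, Isolates M T E y e).card := by
    refine Finset.card_le_card_of_injOn (fun a => a.1 * M + a.2) ?_ ?_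
    · intro a ha
      simp only [iso, S, Finset.coe_biUnion, Finset.mem_coe, Finset.coe_filter, Set.mem_iUnion,
        Set.mem_ofPred_eq, Finset.mem_product, Finset.mem_range, exists_prop] at ha ⊢
      obtain ⟨e, he, ⟨h1, h2⟩, h3, h4⟩ := ha
      refine ⟨by nlinarith, e, he, (kept_mul_add T e h2).2 h3, fun f hf hk => ?_⟩
      exact h4 f hf ((kept_mul_add T f h2).1 hk)
    · have hlt : ∀ a ∈ X.biUnion iso, a.2 < M := by
        intro a ha
        simp only [iso, S, Finset.mem_biUnion, Finset.mem_filter, Finset.mem_product,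
          Finset.mem_range] at ha
        obtain ⟨e, -, h, -⟩ := ha
        exact h.2
      intro a ha b hb hab
      have h1 := hlt a ha
      have h2 := hlt b hb
      have hM : 0 < M := by omega
      have h3 : a.2 = b.2 := by
        have := congrArg (· % M) hab
        simpa [Nat.mul_add_mod_self_right, Nat.mod_eq_of_lt h1, Nat.mod_eq_of_lt h2] using this
      refine Prod.ext ?_ h3
      have hab' : a.1 * M + a.2 = b.1 * M + b.2 := hab
      rw [h3] at hab'
      exact Nat.eq_of_mul_eq_mul_right hM (by omega)
  calc X.card * (M * T) = ∑ e ∈ X, M * T := by rw [Finset.sum_const, smul_eq_mul]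
    _ ≤ ∑ e ∈ X, 2 * (iso e).card := Finset.sum_le_sum hiso
    _ = 2 * (X.biUnion iso).card := by rw [hdisj, Finset.mul_sum]
    _ ≤ _ := Nat.mul_le_mul_left 2 hinj

end Isolation

/-! ### Amplification over independent seeds -/

section Amplification

lemma eq_of_digits_eq {P K Y Z : ℕ} (hY : Y < P ^ K) (hZ : Z < P ^ K)
    (h : ∀ k < K, Y / P ^ k % P = Z / P ^ k % P) : Y = Z := by
  have : finFunctionFinEquiv.symm (⟨Y, hY⟩ : Fin (P ^ K)) =
      finFunctionFinEquiv.symm (⟨Z, hZ⟩ : Fin (P ^ K)) := by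
    funext i
    exact Fin.ext (h i i.2)
  simpa using finFunctionFinEquiv.symm.injective this

/-- The base-`P` digits of a uniform number below `P ^ K` are independent and uniform; in the
form of an upper bound for the number of `Y` with prescribed digits at the places in `J`. -/
lemma card_forall_digit_le {P K : ℕ} (hP : 0 < P) {J : Finset ℕ} (hJ : J ⊆ Finset.range K)
    (bad : ℕ → Prop) [DecidablePred bad] :
    ((Finset.range (P ^ K)).filter fun Y => ∀ k ∈ J, bad (Y / P ^ k % P)).card ≤
      ((Finset.range P).filter bad).card ^ J.card * P ^ (K - J.card) := by
  classical
  let S : Fin K → Finset ℕ := fun i =>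
    if (i : ℕ) ∈ J then (Finset.range P).filter bad else Finset.range P
  have h1 : ((Finset.range (P ^ K)).filter fun Y => ∀ k ∈ J, bad (Y / P ^ k % P)).card ≤
      (Fintype.piFinset S).card := by
    refine Finset.card_le_card_of_injOn (fun Y i => Y / P ^ (i : ℕ) % P) ?_ ?_
    · intro Y hY
      simp only [Finset.coe_filter, Finset.mem_range, Set.mem_ofPred_eq] at hY
      simp only [Finset.mem_coe, Fintype.mem_piFinset, S]
      intro i
      split_ifs with hi
      · simp only [Finset.mem_filter, Finset.mem_range]
        exact ⟨Nat.mod_lt _ hP, hY.2 i hi⟩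
      · simpa using Nat.mod_lt _ hP
    · intro Y hY Z hZ h
      simp only [Finset.coe_filter, Finset.mem_range, Set.mem_ofPred_eq] at hY hZ
      exact eq_of_digits_eq hY.1 hZ.1 fun k hk => congrFun h ⟨k, hk⟩
  refine h1.trans_eq ?_
  rw [Fintype.card_piFinset]
  have h2 : ∀ i : Fin K, (S i).card =
      (fun k => if k ∈ J then ((Finset.range P).filter bad).card else P) (i : ℕ) := by
    intro i
    simp only [S]
    split_ifs <;> simp
  rw [Finset.prod_congr rfl fun i _ => h2 i,
    Fin.prod_univ_eq_prod_range (fun k => if k ∈ J then ((Finset.range P).filter bad).card else P),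
    Finset.prod_ite, Finset.prod_const, Finset.prod_const, Finset.filter_mem_eq_inter,
    Finset.inter_eq_right.2 hJ, ← Finset.sdiff_eq_filter, Finset.card_sdiff_of_subset hJ,
    Finset.card_range]

/-- The threshold that the `k`-th sampler compares hash values with: cyclically
`M, M / 2, M / 4, …, 1` if `M` is a power of two. -/
def threshold (M : ℕ) : ℕ → ℕ
  | 0 => M
  | k + 1 => threshold M k / 2 + M * (1 - threshold M k / 2)

/-- Level `j` of the thresholds occurs at the places congruent to `j` modulo `t + 1`. -/
lemma threshold_two_pow (t q j : ℕ) (hj : j ≤ t) :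
    threshold (2 ^ t) (q * (t + 1) + j) = 2 ^ (t - j) := by
  have step : ∀ k i, i < t → threshold (2 ^ t) k = 2 ^ (t - i) →
      threshold (2 ^ t) (k + 1) = 2 ^ (t - (i + 1)) := by
    intro k i hi h
    rw [threshold, h, show t - i = t - (i + 1) + 1 by omega, pow_succ, Nat.mul_div_cancel _ two_pos,
      Nat.sub_eq_zero_of_le Nat.one_le_two_pow, mul_zero, add_zero]
  have within : ∀ k, threshold (2 ^ t) k = 2 ^ t → ∀ i ≤ t,
      threshold (2 ^ t) (k + i) = 2 ^ (t - i) := by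
    intro k hk i
    induction i with
    | zero => intro _; simpa using hk
    | succ i ih => intro hi; exact step _ i hi (ih (by omega))
  have start : ∀ q, threshold (2 ^ t) (q * (t + 1)) = 2 ^ t := by
    intro q
    induction q with
    | zero => simp [threshold]
    | succ q ih =>
      have := within _ ih t le_rfl
      rw [show (q + 1) * (t + 1) = q * (t + 1) + t + 1 by ring, threshold, this]
      simp
  exact within _ (start q) j hj

/-- Suppose that every `X` in the family `F` holds at least a third of the keys `E`. Then all
but a fraction `|F| (95 / 96) ^ Q` of the seeds `Y` isolate, for each `X` in the family, some
element of `X`. Only the `Q` samplers with the right threshold, between `1 / (16 |E|)` and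
`1 / (8 |E|)` times the modulus, are used. -/
lemma card_seeds_missing_le {N t Q : ℕ} {E : Finset ℕ} (hE : ∀ e ∈ E, e ≤ N) (hE0 : 0 < E.card)
    (hN : 16 * E.card * N ≤ 2 ^ t) (hN1 : 1 ≤ N) {F : Finset (Finset ℕ)} (hFE : ∀ X ∈ F, X ⊆ E)
    (hF : ∀ X ∈ F, E.card ≤ 3 * X.card) :
    ((Finset.range (((2 ^ t) ^ 2) ^ ((t + 1) * Q))).filter fun Y => ∃ X ∈ F,
      ∀ k < (t + 1) * Q, ∀ e ∈ X,
        ¬ Isolates (2 ^ t) (threshold (2 ^ t) k) E (Y / ((2 ^ t) ^ 2) ^ k) e).card * 96 ^ Q ≤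
      F.card * 95 ^ Q * ((2 ^ t) ^ 2) ^ ((t + 1) * Q) := by
  classical
  set M := 2 ^ t with hM
  set P := M ^ 2 with hP
  have hM0 : 0 < M := by positivity
  have hP0 : 0 < P := by positivity
  -- the level `j` is chosen such that `8 |E| ≤ 2 ^ j < 16 |E|`
  obtain ⟨j, hj1, hj2⟩ : ∃ j, 8 * E.card ≤ 2 ^ j ∧ 2 ^ j < 16 * E.card := by
    refine ⟨Nat.clog 2 (8 * E.card), Nat.le_pow_clog one_lt_two _, ?_⟩
    have h1 := Nat.pow_pred_clog_lt_self one_lt_two (x := 8 * E.card) (by omega)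
    have h2 : 0 < Nat.clog 2 (8 * E.card) := Nat.clog_pos one_lt_two (by omega)
    obtain ⟨i, hi⟩ : ∃ i, Nat.clog 2 (8 * E.card) = i + 1 := ⟨_, (Nat.succ_pred_eq_of_pos h2).symm⟩
    rw [hi] at h1 ⊢
    simp only [Nat.pred_eq_sub_one, Nat.add_sub_cancel] at h1
    rw [pow_succ]
    omega
  have hjt : j ≤ t := by
    refine (Nat.pow_le_pow_iff_right one_lt_two).1 (hj2.le.trans (le_trans ?_ hN))
    exact Nat.le_mul_of_pos_right _ hN1
  set T := 2 ^ (t - j) with hT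
  have hTM : T * 2 ^ j = M := by rw [hT, hM, ← pow_add, Nat.sub_add_cancel hjt]
  have hNT : N ≤ T := by
    by_contra hlt
    push Not at hlt
    have : T * 2 ^ j < N * (16 * E.card) := Nat.mul_lt_mul'' hlt hj2
    rw [hTM] at this
    nlinarith
  let good : Finset ℕ → ℕ → Prop := fun X y => ∃ e ∈ X, Isolates M T E y e
  have hbad : ∀ X ∈ F, 96 * ((Finset.range P).filter fun y => ¬ good X y).card ≤ 95 * P := by
    intro X hX
    have h1 := card_isolating_seeds (M := M) (T := T) (hFE X hX) (fun e he => (hE e he).trans hNT)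
      (hTM ▸ Nat.le_mul_of_pos_right _ (by positivity))
      (by rw [← hTM, mul_comm T]; exact Nat.mul_le_mul_right _ hj1)
    have h2 := Finset.card_filter_add_card_filter_not (s := Finset.range P) (good X)
    rw [Finset.card_range] at h2
    have h3 : P ≤ 48 * (X.card * (M * T)) := by
      have h4 : M ≤ 48 * X.card * T := by
        have := hF X hX
        rw [← hTM]
        nlinarith [Nat.mul_le_mul_left T hj2.le, Nat.mul_le_mul_left T this]
      rw [hP, pow_two]
      nlinarith [Nat.mul_le_mul_left M h4]
    have h5 : ((Finset.range (M ^ 2)).filter fun y => ∃ e ∈ X, Isolates M T E y e).card =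
      ((Finset.range P).filter (good X)).card := rfl
    rw [h5] at h1
    omega
  let J : Finset ℕ := (Finset.range Q).image fun q => q * (t + 1) + j
  have hJK : J ⊆ Finset.range ((t + 1) * Q) := by
    intro k hk
    obtain ⟨q, hq, rfl⟩ := Finset.mem_image.1 hk
    rw [Finset.mem_range] at hq ⊢
    nlinarith
  have hJc : J.card = Q := by
    rw [Finset.card_image_of_injective, Finset.card_range]
    intro a b hab
    have : a * (t + 1) = b * (t + 1) := by simpa using hab
    exact Nat.eq_of_mul_eq_mul_right (Nat.succ_pos t) this
  have hsub : ((Finset.range (P ^ ((t + 1) * Q))).filter fun Y => ∃ X ∈ F,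
      ∀ k < (t + 1) * Q, ∀ e ∈ X, ¬ Isolates M (threshold M k) E (Y / P ^ k) e) ⊆
      F.biUnion fun X => (Finset.range (P ^ ((t + 1) * Q))).filter fun Y =>
        ∀ k ∈ J, ¬ good X (Y / P ^ k % P) := by
    intro Y hY
    simp only [Finset.mem_filter, Finset.mem_biUnion] at hY ⊢
    obtain ⟨hY, X, hX, h⟩ := hY
    refine ⟨X, hX, hY, fun k hk => ?_⟩
    rintro ⟨e, he, hi⟩
    refine h k (Finset.mem_range.1 (hJK hk)) e he ?_
    obtain ⟨q, -, rfl⟩ := Finset.mem_image.1 hk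
    rw [hM, threshold_two_pow t q j hjt]
    simpa only [Isolates, hP, kept_mod_sq] using hi
  have hcard := (Finset.card_le_card hsub).trans Finset.card_biUnion_le
  have hQK : Q ≤ (t + 1) * Q := Nat.le_mul_of_pos_left _ (Nat.succ_pos t)
  have hX : ∀ X ∈ F, ((Finset.range (P ^ ((t + 1) * Q))).filter fun Y =>
        ∀ k ∈ J, ¬ good X (Y / P ^ k % P)).card * 96 ^ Q ≤ 95 ^ Q * P ^ ((t + 1) * Q) := by
    intro X hX
    have h1 := card_forall_digit_le hP0 hJK fun y => ¬ good X y
    rw [hJc] at h1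
    calc _ ≤ (((Finset.range P).filter fun y => ¬ good X y).card ^ Q * P ^ ((t + 1) * Q - Q))
          * 96 ^ Q := Nat.mul_le_mul_right _ h1
      _ = (96 * ((Finset.range P).filter fun y => ¬ good X y).card) ^ Q * P ^ ((t + 1) * Q - Q) := by
          rw [mul_pow]; ring
      _ ≤ (95 * P) ^ Q * P ^ ((t + 1) * Q - Q) :=
          Nat.mul_le_mul_right _ (Nat.pow_le_pow_left (hbad X hX) Q)
      _ = 95 ^ Q * P ^ ((t + 1) * Q) := by
          rw [mul_pow, mul_assoc, ← pow_add, Nat.add_sub_cancel' hQK]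
  calc _ ≤ (∑ X ∈ F, ((Finset.range (P ^ ((t + 1) * Q))).filter fun Y =>
        ∀ k ∈ J, ¬ good X (Y / P ^ k % P)).card) * 96 ^ Q := Nat.mul_le_mul_right _ hcard
    _ ≤ ∑ X ∈ F, 95 ^ Q * P ^ ((t + 1) * Q) := by
        rw [Finset.sum_mul]; exact Finset.sum_le_sum hX
    _ = _ := by rw [Finset.sum_const, smul_eq_mul, mul_assoc]

end Amplification

/-! ### Random numbers from coins -/

section Coins

/-- The number whose binary digits, most significant first, are the first `i` coins. -/
def coinValue (ω : ℕ → Bool) : ℕ → ℕ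
  | 0 => 0
  | i + 1 => 2 * coinValue ω i + (ω i).toNat

lemma coinValue_lt (ω : ℕ → Bool) (i : ℕ) : coinValue ω i < 2 ^ i := by
  induction i with
  | zero => simp [coinValue]
  | succ i ih =>
    have := (ω i).toNat_le
    rw [coinValue, pow_succ]
    omega

lemma coinValue_of_testBit {ω : ℕ → Bool} {y N : ℕ} (hy : y < 2 ^ N)
    (h : ∀ i < N, ω i = y.testBit (N - 1 - i)) : coinValue ω N = y := by
  have : ∀ i ≤ N, coinValue ω i = y / 2 ^ (N - i) := by
    intro i
    induction i with
    | zero => intro _; simp [coinValue, Nat.div_eq_of_lt hy]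
    | succ i ih =>
      intro hi
      rw [coinValue, ih (by omega), h i (by omega), Nat.toNat_testBit,
        show N - i = N - 1 - i + 1 by omega, show N - (i + 1) = N - 1 - i by omega, pow_succ,
        ← Nat.div_div_eq_div_mul]
      omega
  simpa using this N le_rfl

instance : IsProbabilityMeasure coinMeasure := by
  unfold coinMeasure
  infer_instance

/-- A random number made from `N` coins lies in `S` with probability at least `|S| / 2 ^ N`. -/
lemma le_coinMeasure {N : ℕ} {S : Finset ℕ} (hS : ∀ y ∈ S, y < 2 ^ N) {A : Set (ℕ → Bool)}
    (hA : ∀ ω, coinValue ω N ∈ S → ω ∈ A) : (S.card : ℝ) / 2 ^ N ≤ coinMeasure.real A := by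
  let cyl : ℕ → Set (ℕ → Bool) := fun y =>
    Set.pi (Finset.range N : Set ℕ) fun i => {y.testBit (N - 1 - i)}
  have hval : ∀ y ∈ S, ∀ ω ∈ cyl y, coinValue ω N = y := by
    intro y hy ω hω
    refine coinValue_of_testBit (hS y hy) fun i hi => ?_
    simpa using hω i (by simpa using hi)
  have hmeas : ∀ y, MeasurableSet (cyl y) := fun y =>
    MeasurableSet.pi (Finset.countable_toSet _) fun _ _ => MeasurableSet.singleton _
  have hcyl : ∀ y, coinMeasure.real (cyl y) = 1 / 2 ^ N := by
    intro y
    have : coinMeasure (cyl y) = (2⁻¹ : ENNReal) ^ N := by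
      unfold coinMeasure
      rw [Measure.infinitePi_pi _ fun _ _ => MeasurableSet.singleton _]
      simp
    rw [measureReal_def, this]
    simp
  have hdisj : (S : Set ℕ).PairwiseDisjoint cyl := by
    intro y hy z hz hyz
    refine Set.disjoint_left.2 fun ω h1 h2 => hyz ?_
    rw [← hval y hy ω h1, hval z hz ω h2]
  calc (S.card : ℝ) / 2 ^ N = ∑ y ∈ S, coinMeasure.real (cyl y) := by
        simp [hcyl, div_eq_mul_inv]
    _ = coinMeasure.real (⋃ y ∈ S, cyl y) :=
        (measureReal_biUnion_finset hdisj fun y _ => hmeas y).symm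
    _ ≤ coinMeasure.real A := by
        refine measureReal_mono ?_ 
        intro ω hω
        simp only [Set.mem_iUnion, exists_prop] at hω
        obtain ⟨y, hy, h⟩ := hω
        exact hA ω (by rw [hval y hy ω h]; exact hy)

end Coins

/-! ### The linear sketch -/

section Sketch

/-- A number that encodes the unordered pair `{u, v}` of numbers below `n`. -/
def pairCode (n u v : ℕ) : ℕ := min u v * n + max u v

lemma pairCode_comm (n u v : ℕ) : pairCode n u v = pairCode n v u := by
  rw [pairCode, pairCode, min_comm, max_comm]

/-- A number that encodes an edge. -/
def edgeCode {n : ℕ} : Sym2 (Fin n) → ℕ :=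
  Sym2.lift ⟨fun u v => pairCode n u v, fun u v => pairCode_comm n u v⟩

@[simp] lemma edgeCode_mk {n : ℕ} (u v : Fin n) : edgeCode s(u, v) = pairCode n u v := rfl

lemma edgeCode_injective {n : ℕ} : Function.Injective (edgeCode (n := n)) := by
  intro e f
  induction e using Sym2.ind with
  | _ u v =>
  induction f using Sym2.ind with
  | _ x y =>
  intro h
  simp only [edgeCode_mk, pairCode] at h
  have hn : 0 < n := u.pos
  have h1 : max (u : ℕ) v < n := max_lt u.2 v.2
  have h2 : max (x : ℕ) y < n := max_lt x.2 y.2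
  have hmax : max (u : ℕ) v = max (x : ℕ) y := by
    have := congrArg (· % n) h
    simpa only [Nat.mul_add_mod_self_right, Nat.mod_eq_of_lt h1, Nat.mod_eq_of_lt h2] using this
  have hmin : min (u : ℕ) v = min (x : ℕ) y := by
    rw [hmax] at h
    exact Nat.eq_of_mul_eq_mul_right hn (by omega)
  rw [Sym2.eq_iff, Fin.ext_iff, Fin.ext_iff, Fin.ext_iff, Fin.ext_iff]
  omega

lemma edgeCode_lt {n : ℕ} (e : Sym2 (Fin n)) : edgeCode e < n ^ 2 := by
  induction e using Sym2.ind with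
  | _ u v =>
  have h1 : max (u : ℕ) v < n := max_lt u.2 v.2
  have h2 : min (u : ℕ) v + 1 ≤ n := by omega
  have h3 := Nat.mul_le_mul_right n h2
  simp only [edgeCode_mk, pairCode]
  nlinarith

lemma card_sym2_fin_le (n : ℕ) : Fintype.card (Sym2 (Fin n)) ≤ n ^ 2 := by
  have := Finset.card_le_card_of_injOn (s := (Finset.univ : Finset (Sym2 (Fin n))))
    (t := Finset.range (n ^ 2)) edgeCode (fun e _ => by simpa using edgeCode_lt e)
    edgeCode_injective.injOn
  simpa using this

/-- `1, e, e ^ 2` as digits in base `W`: what one copy of the key `e` contributes to the digit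
of every sampler that keeps `e`. -/
def moments (W e : ℕ) : ℕ := 1 + e * W + e ^ 2 * W ^ 2

/-- The samplers that keep the key `e`, as digits in base `W ^ 3`. -/
def keptSum (M W Y K e : ℕ) : ℕ :=
  ∑ k ∈ Finset.range K, if Kept M (threshold M k) (Y / (M ^ 2) ^ k) e then (W ^ 3) ^ k else 0

/-- `A` is the sketch of the multiplicities after the updates `τ`. -/
def IsSketch {n : ℕ} (M W Y K : ℕ) (τ : List (Update n)) (A : ℕ) : Prop :=
  (A : ℤ) = ∑ e : Sym2 (Fin n),
    edgeMultiplicity τ e * ((moments W (edgeCode e) * keptSum M W Y K (edgeCode e) : ℕ) : ℤ)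

lemma isSketch_nil {n : ℕ} (M W Y K : ℕ) : IsSketch M W Y K ([] : List (Update n)) 0 := by
  simp [IsSketch, edgeMultiplicity]

lemma edgeMultiplicity_append_singleton {n : ℕ} (τ : List (Update n)) (t : Update n)
    (e : Sym2 (Fin n)) : edgeMultiplicity (τ ++ [t]) e =
      edgeMultiplicity τ e + if t.edge = e then (if t.ins then 1 else -1) else 0 := by
  unfold edgeMultiplicity
  simp only [List.countP_append, List.countP_singleton]
  by_cases he : t.edge = e <;> by_cases hi : t.ins = true <;> simp [he, hi] <;> omega

/-- The number that an update adds to or subtracts from the sketch. -/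
def sketchWeight {n : ℕ} (M W Y K : ℕ) (t : Update n) : ℕ :=
  moments W (edgeCode t.edge) * keptSum M W Y K (edgeCode t.edge)

lemma IsSketch.append_singleton {n M W Y K A : ℕ} {τ : List (Update n)} (t : Update n)
    (h : IsSketch M W Y K τ A)
    (hpos : ∀ e, 0 ≤ edgeMultiplicity (τ ++ [t]) e) :
    IsSketch M W Y K (τ ++ [t])
      (if t.ins then A + sketchWeight M W Y K t else A - sketchWeight M W Y K t) := by
  have hsum : ∑ e : Sym2 (Fin n), edgeMultiplicity (τ ++ [t]) e *
      ((moments W (edgeCode e) * keptSum M W Y K (edgeCode e) : ℕ) : ℤ) =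
      A + (if t.ins then 1 else -1) * (sketchWeight M W Y K t : ℤ) := by
    rw [h]
    simp only [edgeMultiplicity_append_singleton, add_mul, Finset.sum_add_distrib, ite_mul,
      zero_mul, Finset.sum_ite_eq, Finset.mem_univ, if_true]
    rfl
  unfold IsSketch
  rw [hsum]
  by_cases hi : t.ins = true
  · simp [hi]
  · have hnn : 0 ≤ ∑ e : Sym2 (Fin n), edgeMultiplicity (τ ++ [t]) e *
        ((moments W (edgeCode e) * keptSum M W Y K (edgeCode e) : ℕ) : ℤ) :=
      Finset.sum_nonneg fun e _ => mul_nonneg (hpos e) (Int.natCast_nonneg _)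
    rw [hsum] at hnn
    simp only [hi, Bool.false_eq_true, if_false, neg_mul, one_mul] at hnn ⊢
    rw [Nat.cast_sub (by omega)]
    ring

lemma sum_mul_pow_lt {B : ℕ} {d : ℕ → ℕ} (hd : ∀ k, d k < B) (K : ℕ) :
    ∑ k ∈ Finset.range K, d k * B ^ k < B ^ K := by
  induction K with
  | zero => simp
  | succ K ih =>
    rw [Finset.sum_range_succ, pow_succ]
    nlinarith [Nat.mul_le_mul_right (B ^ K) (hd K)]

lemma sum_mul_pow_div_mod {B : ℕ} (j : ℕ) : ∀ {d : ℕ → ℕ} (_ : ∀ k, d k < B) {K : ℕ} (_ : j < K),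
    (∑ k ∈ Finset.range K, d k * B ^ k) / B ^ j % B = d j := by
  induction j with
  | zero =>
    intro d hd K hK
    obtain ⟨K, rfl⟩ : ∃ K', K = K' + 1 := ⟨K - 1, by omega⟩
    rw [Finset.sum_range_succ']
    simp only [pow_succ, ← mul_assoc, ← Finset.sum_mul, pow_zero, mul_one, Nat.div_one]
    rw [Nat.mul_add_mod_self_right, Nat.mod_eq_of_lt (hd 0)]
  | succ j ih =>
    intro d hd K hK
    obtain ⟨K, rfl⟩ : ∃ K', K = K' + 1 := ⟨K - 1, by omega⟩
    have hB : 0 < B := (Nat.zero_le _).trans_lt (hd 0)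
    rw [pow_succ', ← Nat.div_div_eq_div_mul, Finset.sum_range_succ']
    simp only [pow_succ, ← mul_assoc, ← Finset.sum_mul, pow_zero, mul_one]
    rw [add_comm, Nat.add_mul_div_right _ _ hB, Nat.div_eq_of_lt (hd 0), zero_add]
    exact ih (fun k => hd (k + 1)) (by omega)

/-- The digit `d` of a sampler shows the moments of a multiple of the single key `e`. -/
def Detects (W d e : ℕ) : Prop := d ≠ 0 ∧ d = d % W * moments W e

instance (W d e : ℕ) : Decidable (Detects W d e) := inferInstanceAs (Decidable (_ ∧ _))

/-- Some sampler of the sketch `A` has isolated the key `e`. -/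
def Recovers (W K A e : ℕ) : Prop := ∃ k < K, Detects W (A / (W ^ 3) ^ k % W ^ 3) e

/-- The graph formed by the edges recovered from the sketch. -/
def recoveredGraph (n W K A : ℕ) : SimpleGraph (Fin n) where
  Adj u v := u ≠ v ∧ Recovers W K A (pairCode n u v)
  symm := ⟨fun u v h => ⟨h.1.symm, by rw [pairCode_comm]; exact h.2⟩⟩
  loopless := ⟨fun _ h => h.1 rfl⟩

lemma mem_edgeSet_recoveredGraph {n W K A : ℕ} {e : Sym2 (Fin n)} (he : ¬ e.IsDiag)
    (h : Recovers W K A (edgeCode e)) : e ∈ (recoveredGraph n W K A).edgeSet := by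
  induction e using Sym2.ind with
  | _ u v => exact ⟨he, h⟩

lemma eq_and_eq_and_eq_of_digits {W a b q a' b' q' : ℕ} (ha : a < W) (hb : b < W)
    (ha' : a' < W) (hb' : b' < W) (h : a + b * W + q * W ^ 2 = a' + b' * W + q' * W ^ 2) :
    a = a' ∧ b = b' ∧ q = q' := by
  have hW : 0 < W := by omega
  have h' : a + W * (b + W * q) = a' + W * (b' + W * q') := by linarith
  have h1 : a = a' := by
    have := congrArg (· % W) h'
    simpa [Nat.mod_eq_of_lt ha, Nat.mod_eq_of_lt ha'] using this
  have h2 : b + W * q = b' + W * q' := by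
    rw [h1] at h'
    exact Nat.eq_of_mul_eq_mul_left hW (by omega)
  have h3 : b = b' := by
    have := congrArg (· % W) h2
    simpa [Nat.mod_eq_of_lt hb, Nat.mod_eq_of_lt hb'] using this
  rw [h3] at h2
  exact ⟨h1, h3, Nat.eq_of_mul_eq_mul_left hW (by omega)⟩

variable {n a : ℕ} {x : Sym2 (Fin n) → ℕ}

/-- If all weights are at most `n ^ a`, then the three moments of the weights that one sampler
keeps are below `W = n ^ (a + 6) + 1`. -/
lemma sum_weights_le (hx : ∀ e, x e ≤ n ^ a) (p : Sym2 (Fin n) → Prop)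
    [DecidablePred p] {g : ℕ → ℕ} (hg : ∀ c < n ^ 2, g c ≤ n ^ 4) :
    ∑ e, (if p e then x e else 0) * g (edgeCode e) < n ^ (a + 6) + 1 := by
  have h : ∀ e ∈ (Finset.univ : Finset (Sym2 (Fin n))),
      (if p e then x e else 0) * g (edgeCode e) ≤ n ^ a * n ^ 4 := by
    intro e _
    refine Nat.mul_le_mul ?_ (hg _ (edgeCode_lt e))
    split_ifs
    · exact hx e
    · exact Nat.zero_le _
  refine Nat.lt_succ_of_le ((Finset.sum_le_card_nsmul _ _ _ h).trans ?_)
  rw [smul_eq_mul, Finset.card_univ, show n ^ (a + 6) = n ^ 2 * (n ^ a * n ^ 4) by ring]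
  exact Nat.mul_le_mul_right _ (card_sym2_fin_le n)

/-- The moments of the weights `x` on the edges in `p`. -/
def momentSum (x : Sym2 (Fin n) → ℕ) (W : ℕ) (p : Sym2 (Fin n) → Prop) [DecidablePred p] : ℕ :=
  ∑ e, (if p e then x e else 0) * moments W (edgeCode e)

lemma momentSum_eq (x : Sym2 (Fin n) → ℕ) (W : ℕ) (p : Sym2 (Fin n) → Prop) [DecidablePred p] :
    momentSum x W p = ∑ e, (if p e then x e else 0) * 1 +
      (∑ e, (if p e then x e else 0) * edgeCode e) * W +
      (∑ e, (if p e then x e else 0) * edgeCode e ^ 2) * W ^ 2 := by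
  simp only [momentSum, moments, Finset.sum_mul, ← Finset.sum_add_distrib]
  refine Finset.sum_congr rfl fun e _ => ?_
  ring

section Bounded

variable (hn : 1 ≤ n) (hx : ∀ e, x e ≤ n ^ a) (p : Sym2 (Fin n) → Prop) [DecidablePred p]
include hn hx

lemma momentSum_lt : momentSum x (n ^ (a + 6) + 1) p < (n ^ (a + 6) + 1) ^ 3 := by
  have h0 := sum_weights_le hx p (g := fun _ => 1) (fun c _ => Nat.one_le_pow _ _ hn)
  have h1 := sum_weights_le hx p (g := fun c => c)
    (fun c hc => hc.le.trans (Nat.pow_le_pow_right hn (by norm_num)))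
  have h2 := sum_weights_le hx p (g := fun c => c ^ 2)
    (fun c hc => (Nat.pow_le_pow_left hc.le 2).trans_eq (by ring))
  rw [momentSum_eq]
  generalize n ^ (a + 6) + 1 = W at *
  generalize ∑ e, (if p e then x e else 0) * 1 = s₀ at *
  generalize ∑ e, (if p e then x e else 0) * edgeCode e = s₁ at *
  generalize ∑ e, (if p e then x e else 0) * edgeCode e ^ 2 = s₂ at *
  have e1 : s₁ * W + W ≤ W * W := by nlinarith
  have e2 : s₂ * W ^ 2 + W ^ 2 ≤ W * W ^ 2 := by nlinarith [Nat.mul_le_mul_right (W ^ 2) h2]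
  nlinarith

/-- Detection is sound: equality of the moments means `∑ x_f (f - e) ^ 2 = 0`. -/
lemma pos_of_detects {e : Sym2 (Fin n)}
    (h : Detects (n ^ (a + 6) + 1) (momentSum x (n ^ (a + 6) + 1) p) (edgeCode e)) : 0 < x e := by
  have h0 := sum_weights_le hx p (g := fun _ => 1) (fun c _ => Nat.one_le_pow _ _ hn)
  have h1 := sum_weights_le hx p (g := fun c => c)
    (fun c hc => hc.le.trans (Nat.pow_le_pow_right hn (by norm_num)))
  have h0' := sum_weights_le hx p (g := fun _ => edgeCode e)
    (fun c hc => (edgeCode_lt e).le.trans (Nat.pow_le_pow_right hn (by norm_num)))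
  obtain ⟨hne, heq⟩ := h
  have hmod : momentSum x (n ^ (a + 6) + 1) p % (n ^ (a + 6) + 1) =
      ∑ e, (if p e then x e else 0) * 1 := by
    rw [momentSum_eq, show ∀ s₀ s₁ s₂ W : ℕ, s₀ + s₁ * W + s₂ * W ^ 2 =
      s₀ + W * (s₁ + s₂ * W) by intros; ring, Nat.add_mul_mod_self_left, Nat.mod_eq_of_lt h0]
  rw [hmod, momentSum_eq, moments] at heq
  have heq' := heq.trans (show _ = ∑ e, (if p e then x e else 0) * 1 +
      (∑ e, if p e then x e else 0) * edgeCode e * (n ^ (a + 6) + 1) +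
      (∑ e, if p e then x e else 0) * edgeCode e ^ 2 * (n ^ (a + 6) + 1) ^ 2 by
    simp only [mul_one]; ring)
  obtain ⟨-, hb, hq⟩ := eq_and_eq_and_eq_of_digits h0 h1 h0 (by rwa [← Finset.sum_mul] at h0') heq'
  have hzero : ∑ f, (((if p f then x f else 0 : ℕ) : ℤ) *
      ((edgeCode f : ℤ) - edgeCode e) ^ 2) = 0 := by
    have hb' : ∑ f, ((if p f then x f else 0 : ℕ) : ℤ) * edgeCode f =
      (∑ f, ((if p f then x f else 0 : ℕ) : ℤ)) * edgeCode e := by exact_mod_cast hb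
    have hq' : ∑ f, ((if p f then x f else 0 : ℕ) : ℤ) * (edgeCode f : ℤ) ^ 2 =
      (∑ f, ((if p f then x f else 0 : ℕ) : ℤ)) * (edgeCode e : ℤ) ^ 2 := by exact_mod_cast hq
    have : ∀ f : Sym2 (Fin n), ((if p f then x f else 0 : ℕ) : ℤ) *
        ((edgeCode f : ℤ) - edgeCode e) ^ 2 =
        ((if p f then x f else 0 : ℕ) : ℤ) * (edgeCode f : ℤ) ^ 2 -
        (((if p f then x f else 0 : ℕ) : ℤ) * edgeCode f) * (2 * edgeCode e) +
        ((if p f then x f else 0 : ℕ) : ℤ) * (edgeCode e : ℤ) ^ 2 := by intro f; ring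
    simp only [this, Finset.sum_add_distrib, Finset.sum_sub_distrib, ← Finset.sum_mul]
    rw [hb', hq']
    ring
  rw [Finset.sum_eq_zero_iff_of_nonneg fun f _ => by positivity] at hzero
  obtain ⟨f, hf⟩ : ∃ f, (if p f then x f else 0) ≠ 0 := by
    by_contra hall
    push Not at hall
    exact hne (by simp [momentSum, hall])
  have hfe := hzero f (Finset.mem_univ f)
  rw [mul_eq_zero] at hfe
  have hfe' : (edgeCode f : ℤ) = edgeCode e := by
    rcases hfe with h' | h'
    · exact absurd (by exact_mod_cast h') hf
    · exact sub_eq_zero.1 (pow_eq_zero_iff (by norm_num) |>.1 h')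
  rw [← edgeCode_injective (by exact_mod_cast hfe' : edgeCode f = edgeCode e)]
  split_ifs at hf <;> omega

lemma detects_of_forall {e : Sym2 (Fin n)} (he : 0 < x e) (hpe : p e)
    (huniq : ∀ f, p f → 0 < x f → f = e) :
    Detects (n ^ (a + 6) + 1) (momentSum x (n ^ (a + 6) + 1) p) (edgeCode e) := by
  have h : momentSum x (n ^ (a + 6) + 1) p = x e * moments (n ^ (a + 6) + 1) (edgeCode e) := by
    rw [momentSum, Finset.sum_eq_single e, if_pos hpe]
    · intro f _ hfe
      split_ifs with hpf
      · have : x f = 0 := by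
          by_contra h0
          exact hfe (huniq f hpf (Nat.pos_of_ne_zero h0))
        rw [this, zero_mul]
      · rw [zero_mul]
    · simp
  have hlt : x e < n ^ (a + 6) + 1 :=
    Nat.lt_succ_of_le ((hx e).trans (Nat.pow_le_pow_right hn (by omega)))
  refine ⟨?_, ?_⟩
  · rw [h, moments]
    positivity
  · rw [h]
    congr 1
    rw [moments, show ∀ s c W : ℕ, s * (1 + c * W + c ^ 2 * W ^ 2) =
      s + W * (s * (c + c ^ 2 * W)) by intros; ring, Nat.add_mul_mod_self_left,
      Nat.mod_eq_of_lt hlt]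

end Bounded

section Final

variable {M K Y A : ℕ} {τ : List (Update n)}

lemma IsSketch.eq_sum {W : ℕ} (h : IsSketch M W Y K τ A) (hpos : ∀ e, 0 ≤ edgeMultiplicity τ e) :
    A = ∑ k ∈ Finset.range K, momentSum (fun e => (edgeMultiplicity τ e).toNat) W
      (fun e => Kept M (threshold M k) (Y / (M ^ 2) ^ k) (edgeCode e)) * (W ^ 3) ^ k := by
  have h1 : (A : ℤ) = ((∑ e : Sym2 (Fin n), (edgeMultiplicity τ e).toNat *
      (moments W (edgeCode e) * keptSum M W Y K (edgeCode e)) : ℕ) : ℤ) := by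
    rw [h, Nat.cast_sum]
    refine Finset.sum_congr rfl fun e _ => ?_
    rw [Nat.cast_mul (edgeMultiplicity τ e).toNat, Int.toNat_of_nonneg (hpos e)]
  rw [Nat.cast_inj.1 h1]
  simp only [momentSum, keptSum, Finset.mul_sum, Finset.sum_mul]
  rw [Finset.sum_comm]
  refine Finset.sum_congr rfl fun k _ => Finset.sum_congr rfl fun e _ => ?_
  split_ifs
  · ring
  · simp

variable (hn : 1 ≤ n) (hpos : ∀ e, 0 ≤ edgeMultiplicity τ e)
  (hle : ∀ e, edgeMultiplicity τ e ≤ (n ^ a : ℕ))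
  (h : IsSketch M (n ^ (a + 6) + 1) Y K τ A)
include hn hpos hle h

lemma IsSketch.lt : A < ((n ^ (a + 6) + 1) ^ 3) ^ K := by
  rw [h.eq_sum hpos]
  exact sum_mul_pow_lt (fun k => momentSum_lt hn (fun e => Int.toNat_le.2 (hle e)) _) K

lemma IsSketch.digit {k : ℕ} (hk : k < K) :
    A / ((n ^ (a + 6) + 1) ^ 3) ^ k % (n ^ (a + 6) + 1) ^ 3 =
      momentSum (fun e => (edgeMultiplicity τ e).toNat) (n ^ (a + 6) + 1)
        fun e => Kept M (threshold M k) (Y / (M ^ 2) ^ k) (edgeCode e) := by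
  rw [h.eq_sum hpos]
  exact sum_mul_pow_div_mod k (fun k => momentSum_lt hn (fun e => Int.toNat_le.2 (hle e)) _) hk

lemma IsSketch.pos_of_recovers {e : Sym2 (Fin n)}
    (hr : Recovers (n ^ (a + 6) + 1) K A (edgeCode e)) : 0 < edgeMultiplicity τ e := by
  obtain ⟨k, hk, hd⟩ := hr
  rw [h.digit hn hpos hle hk] at hd
  have := pos_of_detects hn (fun e => Int.toNat_le.2 (hle e)) _ hd
  omega

lemma IsSketch.recovers {E : Finset ℕ} (hE : ∀ f, 0 < edgeMultiplicity τ f → edgeCode f ∈ E)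
    {e : Sym2 (Fin n)} (he : 0 < edgeMultiplicity τ e) {k : ℕ} (hk : k < K)
    (hi : Isolates M (threshold M k) E (Y / (M ^ 2) ^ k) (edgeCode e)) :
    Recovers (n ^ (a + 6) + 1) K A (edgeCode e) := by
  refine ⟨k, hk, ?_⟩
  rw [h.digit hn hpos hle hk]
  refine detects_of_forall hn (fun e => Int.toNat_le.2 (hle e)) _ (by omega) hi.1 ?_
  intro f hf hf0
  exact edgeCode_injective (hi.2 _ (hE f (by omega)) hf)

end Final

end Sketch

/-! ### Verification of programs -/

section Verification

instance : Add Arith := ⟨.add⟩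
instance : Sub Arith := ⟨.sub⟩
instance : Mul Arith := ⟨.mul⟩
instance : Div Arith := ⟨.div⟩
instance : Mod Arith := ⟨.mod⟩
instance (k : ℕ) : OfNat Arith k := ⟨.const k⟩

/-- The content of the register with the fixed address `i`. -/
def reg (i : ℕ) : Arith := .get (.const i)

/-- The truth value of `p`, as the machine represents it. -/
noncomputable def flag (p : Prop) : ℕ := open Classical in if p then 1 else 0

lemma flag_of {p : Prop} (h : p) : flag p = 1 := if_pos h

lemma flag_of_not {p : Prop} (h : ¬ p) : flag p = 0 := if_neg h

lemma flag_le_one (p : Prop) : flag p ≤ 1 := by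
  by_cases h : p
  · rw [flag_of h]
  · rw [flag_of_not h]; exact Nat.zero_le 1

lemma flag_ne_zero {p : Prop} : flag p ≠ 0 ↔ p := by
  by_cases h : p
  · rw [flag_of h]; simp [h]
  · rw [flag_of_not h]; simp [h]

/-- `1` if `x` is nonzero, and `0` otherwise. -/
def Arith.nonzero (x : Arith) : Arith := 1 - (1 - x)

/-- `1` if `x` and `y` differ, and `0` otherwise. -/
def Arith.differ (x y : Arith) : Arith := .nonzero ((x - y) + (y - x))

/-- `1` if `x < y`, and `0` otherwise. -/
def Arith.less (x y : Arith) : Arith := 1 - (x + 1 - y)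

/-- The power with a fixed exponent. -/
def Arith.power (x : Arith) : ℕ → Arith
  | 0 => 1
  | k + 1 => x.power k * x

section Eval

variable (m : Mem) (x y : Arith)

@[simp] lemma Arith.eval_add : (x + y).eval m = x.eval m + y.eval m := rfl
@[simp] lemma Arith.eval_sub : (x - y).eval m = x.eval m - y.eval m := rfl
@[simp] lemma Arith.eval_mul : (x * y).eval m = x.eval m * y.eval m := rfl
@[simp] lemma Arith.eval_div : (x / y).eval m = x.eval m / y.eval m := rfl
@[simp] lemma Arith.eval_mod : (x % y).eval m = x.eval m % y.eval m := rfl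
@[simp] lemma Arith.eval_ofNat (k : ℕ) : (no_index (OfNat.ofNat k : Arith)).eval m = k := rfl
@[simp] lemma Arith.eval_const (k : ℕ) : (Arith.const k).eval m = k := rfl
@[simp] lemma Arith.eval_reg (i : ℕ) : (reg i).eval m = m i := rfl

@[simp] lemma Arith.eval_nonzero : x.nonzero.eval m = flag (x.eval m ≠ 0) := by
  simp only [Arith.nonzero, Arith.eval_sub, Arith.eval_ofNat, flag]
  split_ifs <;> omega

@[simp] lemma Arith.eval_differ : (x.differ y).eval m = flag (x.eval m ≠ y.eval m) := by
  rw [Arith.differ, Arith.eval_nonzero]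
  refine congrArg flag (propext ?_)
  rw [Arith.eval_add, Arith.eval_sub, Arith.eval_sub]
  omega

@[simp] lemma Arith.eval_less : (x.less y).eval m = flag (x.eval m < y.eval m) := by
  simp only [Arith.less, Arith.eval_sub, Arith.eval_add, Arith.eval_ofNat, flag]
  split_ifs <;> omega

@[simp] lemma Arith.eval_power (k : ℕ) : (x.power k).eval m = x.eval m ^ k := by
  induction k with
  | zero => rfl
  | succ k ih => rw [Arith.power, Arith.eval_mul, ih, pow_succ]

end Eval

/-- Store the value of `x` in the register with the fixed address `i`. -/
def assign (i : ℕ) (x : Arith) : Program := .set (.const i) x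

infixr:60 ";;" => Program.seq
infix:62 "<~" => assign

variable {n L : ℕ}

section Write

variable (s : Config n) (i x : ℕ)

@[simp] lemma Config.write_mem (r : ℕ) :
    (s.write i x).mem r = if r = i then x else s.mem r := by
  simp [Config.write, Function.update_apply]

@[simp] lemma Config.write_input : (s.write i x).input = s.input := rfl
@[simp] lemma Config.write_coins : (s.write i x).coins = s.coins := rfl
@[simp] lemma Config.write_output : (s.write i x).output = s.output := rfl

end Write

/-- Only the first `32` registers are in use, their contents have at most `L` bits, and so it
has been from the start. -/
structure Fits (L : ℕ) (s : Config n) : Prop where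
  lt : ∀ r, s.mem r < 2 ^ L
  eq_zero : ∀ r, 32 ≤ r → s.mem r = 0
  peak_le : s.peak ≤ 32 * (5 + L)

lemma bits_le {m : Mem} (h : ∀ r, m r < 2 ^ L) (h0 : ∀ r, 32 ≤ r → m r = 0) :
    m.bits ≤ 32 * (5 + L) := by
  have hsub : m.support ⊆ Finset.range 32 := by
    intro r hr
    rw [Finsupp.mem_support_iff] at hr
    rw [Finset.mem_range]
    by_contra hlt
    exact hr (h0 r (by omega))
  have hterm : ∀ r ∈ m.support, r.size + (m r).size ≤ 5 + L := by
    intro r hr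
    refine Nat.add_le_add (Nat.size_le.2 ?_) (Nat.size_le.2 (h r))
    simpa using hsub hr
  refine (Finset.sum_le_card_nsmul _ _ _ hterm).trans ?_
  rw [smul_eq_mul]
  exact Nat.mul_le_mul_right _ (by simpa using Finset.card_le_card hsub)

lemma Fits.write {s : Config n} (h : Fits L s) {i x : ℕ} (hi : i < 32) (hx : x < 2 ^ L) :
    Fits L (s.write i x) := by
  have h1 : ∀ r, (s.write i x).mem r < 2 ^ L := by
    intro r
    rw [Config.write_mem]
    split_ifs
    · exact hx
    · exact h.lt r
  have h2 : ∀ r, 32 ≤ r → (s.write i x).mem r = 0 := by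
    intro r hr
    rw [Config.write_mem, if_neg (by omega)]
    exact h.eq_zero r hr
  exact ⟨h1, h2, max_le h.peak_le (bits_le h1 h2)⟩

/-- Total correctness: from `s`, the program terminates, within the space bound, in a state
that satisfies `Q`. -/
def Ensures (L : ℕ) (p : Program) (s : Config n) (Q : Config n → Prop) : Prop :=
  Fits L s → ∃ s', Exec p s s' ∧ Fits L s' ∧ Q s'

section Rules

variable {p q : Program} {s : Config n} {Q R : Config n → Prop}

lemma Ensures.mono (h : Ensures L p s Q) (hQ : ∀ s', Fits L s' → Q s' → R s') :
    Ensures L p s R := fun hs =>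
  let ⟨s', he, hf, hq⟩ := h hs
  ⟨s', he, hf, hQ s' hf hq⟩

lemma Ensures.of_fits (h : Fits L s → Ensures L p s Q) : Ensures L p s Q := fun hs => h hs hs

lemma Ensures.skip (h : Q s) : Ensures L .skip s Q := fun hs => ⟨s, .skip s, hs, h⟩

lemma Ensures.seq (h : Ensures L p s fun s' => Ensures L q s' Q) : Ensures L (p;;q) s Q :=
  fun hs =>
    let ⟨_, he, hf, hq⟩ := h hs
    let ⟨s'', he', hf', hq'⟩ := hq hf
    ⟨s'', .seq he he', hf', hq'⟩

lemma Ensures.ite {x : Arith} (h₁ : x.eval s.mem ≠ 0 → Ensures L p s Q)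
    (h₂ : x.eval s.mem = 0 → Ensures L q s Q) : Ensures L (.ite x p q) s Q := by
  intro hs
  by_cases hx : x.eval s.mem = 0
  · obtain ⟨s', he, h⟩ := h₂ hx hs
    exact ⟨s', .ite_false hx he, h⟩
  · obtain ⟨s', he, h⟩ := h₁ hx hs
    exact ⟨s', .ite_true hx he, h⟩

lemma Ensures.assign {i : ℕ} {x : Arith} (hi : i < 32) (hx : x.eval s.mem < 2 ^ L)
    (h : Q (s.write i (x.eval s.mem))) : Ensures L (i <~ x) s Q := fun hs =>
  ⟨_, .set (.const i) x s, hs.write hi hx, h⟩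

/-- An assignment followed by another program. -/
lemma Ensures.assign_seq {i : ℕ} {x : Arith} (hi : i < 32) (hx : x.eval s.mem < 2 ^ L)
    (h : Ensures L q (s.write i (x.eval s.mem)) Q) : Ensures L (i <~ x;;q) s Q :=
  .seq (.assign hi hx h)

lemma Ensures.flip {i : ℕ} (hi : i < 32) (hL : 0 < L) (h : Q (s.flip i)) :
    Ensures L (.flip (.const i)) s Q := fun hs => by
  refine ⟨_, .flip (.const i) s, ?_, h⟩
  have h1 : Fits L { s with coins := fun i => s.coins (i + 1) } := ⟨hs.1, hs.2, hs.3⟩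
  exact h1.write hi
    ((Bool.toNat_le _).trans_lt (Nat.one_lt_two_pow hL.ne'))

lemma Ensures.emit {x : Arith} (h : Q { s with output := s.output ++ [x.eval s.mem] }) :
    Ensures L (.emit x) s Q := fun hs =>
  ⟨_, .emit x s, ⟨hs.1, hs.2, hs.3⟩, h⟩

/-- Loops: an invariant `I` and a decreasing quantity `v`. -/
lemma Ensures.loop {x : Arith} (I : Config n → Prop) (v : Config n → ℕ) (hI : I s)
    (h : ∀ s', I s' → x.eval s'.mem ≠ 0 → Ensures L p s' fun s'' => I s'' ∧ v s'' < v s') :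
    Ensures L (.loop x p) s fun s' => I s' ∧ x.eval s'.mem = 0 := by
  have key : ∀ k, ∀ s', v s' < k → I s' →
      Ensures L (.loop x p) s' fun s' => I s' ∧ x.eval s'.mem = 0 := by
    intro k
    induction k with
    | zero => intro s' hv; exact absurd hv (Nat.not_lt_zero _)
    | succ k ih =>
      intro s' hv hI' hs'
      by_cases hx : x.eval s'.mem = 0
      · exact ⟨s', .loop_done hx, hs', hI', hx⟩
      · obtain ⟨s'', he, hf, hI'', hv'⟩ := h s' hI' hx hs'
        obtain ⟨s₃, he', hf', hq⟩ := ih s'' (by omega) hI'' hf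
        exact ⟨s₃, .loop_step hx he he', hf', hq⟩
  exact key _ s (Nat.lt_succ_self _) hI

end Rules

/-- Outside the registers in `l`, the memory, the input, the coins and the output of `s'` are
those of `s`. -/
structure SameExcept (l : List ℕ) (s s' : Config n) : Prop where
  mem : ∀ r, r ∉ l → s'.mem r = s.mem r
  input : s'.input = s.input
  coins : s'.coins = s.coins
  output : s'.output = s.output

section SameExcept

variable {l l' : List ℕ} {s s' s'' : Config n}

lemma SameExcept.refl : SameExcept l s s := ⟨fun _ _ => rfl, rfl, rfl, rfl⟩

lemma SameExcept.trans (h : SameExcept l s s') (h' : SameExcept l' s' s'') (hl : l' ⊆ l) :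
    SameExcept l s s'' :=
  ⟨fun r hr => (h'.mem r fun h => hr (hl h)).trans (h.mem r hr), h'.input.trans h.input,
    h'.coins.trans h.coins, h'.output.trans h.output⟩

lemma SameExcept.write (h : SameExcept l s s') {i x : ℕ} (hi : i ∈ l) :
    SameExcept l s (s'.write i x) := by
  refine ⟨fun r hr => ?_, h.input, h.coins, h.output⟩
  have hne : r ≠ i := fun e => hr (e ▸ hi)
  rw [Config.write_mem, if_neg hne]
  exact h.mem r hr

end SameExcept

end Verification

/-! ### The hash values of an edge -/

section Samplers

variable {n L : ℕ}

-- The register allocation. `rN`: number of vertices; `rM`: modulus; `rLev`: number of levels;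
-- `rK`: number of samplers; `rW`: base of the sketch; `rY`: seeds; `rD`: number of possible seeds;
-- `rA`: sketch; `rKind`, `rU`, `rV`: current update (`rV` is also the current digit of a path);
-- `rC`: loop counter; `rPw`: current place value; `rS`: number whose digits are being read;
-- `rT`: threshold; `rZ`: result of `runSamplers`; `rE`: key of an edge; `rP`: code of a path;
-- `rOk`: whether `rP` is valid so far; `rX`: digits of `rP` not yet checked; `rG`: whether an edge
-- was found; `rB`: random bit.
notation "rN" => (0 : ℕ)
notation "rM" => (1 : ℕ)
notation "rLev" => (2 : ℕ)
notation "rK" => (3 : ℕ)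
notation "rW" => (4 : ℕ)
notation "rY" => (5 : ℕ)
notation "rD" => (6 : ℕ)
notation "rA" => (7 : ℕ)
notation "rKind" => (8 : ℕ)
notation "rU" => (9 : ℕ)
notation "rV" => (10 : ℕ)
notation "rC" => (11 : ℕ)
notation "rPw" => (12 : ℕ)
notation "rS" => (13 : ℕ)
notation "rT" => (14 : ℕ)
notation "rZ" => (15 : ℕ)
notation "rE" => (16 : ℕ)
notation "rP" => (17 : ℕ)
notation "rOk" => (18 : ℕ)
notation "rX" => (19 : ℕ)
notation "rG" => (20 : ℕ)
notation "rB" => (21 : ℕ)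

/-- One step for each sampler: `rS` holds the seeds not yet used, as digits in base `M ^ 2`, and `rT`
runs through the values of `threshold`. -/
def samplerLoop : Program :=
  .loop (reg rC)
    (rZ <~ reg rZ + reg rPw *
        ((reg rS / reg rM * reg rE + reg rS) % reg rM).less (reg rT);;
      rPw <~ reg rPw * (reg rW).power 3;;
      rS <~ reg rS / (reg rM).power 2;;
      rT <~ reg rT / 2 + reg rM * (1 - reg rT / 2);;
      rC <~ reg rC - 1)

/-- Evaluate all samplers at the key in `rE`; the result is in `rZ`. -/
def runSamplers : Program :=
  rC <~ reg rK;; rPw <~ 1;; rS <~ reg rY;; rT <~ reg rM;; rZ <~ 0;; samplerLoop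

lemma threshold_le (M k : ℕ) : threshold M k ≤ M := by
  induction k with
  | zero => exact le_rfl
  | succ k ih =>
    rw [threshold]
    rcases Nat.eq_zero_or_pos (threshold M k / 2) with h | h
    · simp [h]
    · rw [Nat.sub_eq_zero_of_le h, mul_zero, add_zero]
      exact (Nat.div_le_self _ _).trans ih

lemma keptSum_lt {M W Y K e : ℕ} (hW : 2 ≤ W) : keptSum M W Y K e < (W ^ 3) ^ K := by
  have h2 : 2 ≤ W ^ 3 := hW.trans (Nat.le_self_pow (by norm_num) W)
  refine lt_of_le_of_lt ?_ (sum_mul_pow_lt (d := fun _ => 1) (fun _ => h2) K)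
  refine Finset.sum_le_sum fun k _ => ?_
  split_ifs <;> simp

lemma ensures_runSamplers {s : Config n} (hW : 2 ≤ s.mem rW)
    (hL : (s.mem rW ^ 3) ^ s.mem rK < 2 ^ L) :
    Ensures L runSamplers s fun s' =>
      s'.mem rZ = keptSum (s.mem rM) (s.mem rW) (s.mem rY) (s.mem rK) (s.mem rE) ∧
        SameExcept [rC, rPw, rS, rT, rZ] s s' := by
  refine .of_fits fun hs => ?_
  have h1 : 1 < 2 ^ L := lt_of_le_of_lt (Nat.one_le_pow _ _ (by positivity)) hL
  refine .assign_seq (by norm_num) (hs.lt _) ?_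
  refine .assign_seq (by norm_num) h1 ?_
  refine .assign_seq (by norm_num) (by simpa using hs.lt _) ?_
  refine .assign_seq (by norm_num) (by simpa using hs.lt _) ?_
  refine .assign_seq (by norm_num) (by simp) ?_
  refine (Ensures.loop (fun s' => ∃ k ≤ s.mem rK, s'.mem rC = s.mem rK - k ∧
      s'.mem rPw = (s.mem rW ^ 3) ^ k ∧ s'.mem rS = s.mem rY / (s.mem rM ^ 2) ^ k ∧
      s'.mem rT = threshold (s.mem rM) k ∧
      s'.mem rZ = keptSum (s.mem rM) (s.mem rW) (s.mem rY) k (s.mem rE) ∧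
      SameExcept [rC, rPw, rS, rT, rZ] s s') (fun s' => s'.mem rC) ?_ ?_).mono ?_
  · refine ⟨0, Nat.zero_le _, by simp, by simp, by simp, by simp [threshold], by simp [keptSum], ?_⟩
    exact ((((SameExcept.refl.write (by simp)).write (by simp)).write (by simp)).write
      (by simp)).write (by simp)
  · rintro s' ⟨k, hk, hc, hpw, hS, hT, hZ, hsame⟩ hne
    simp only [Arith.eval_reg] at hne
    have hkK : k < s.mem rK := by omega
    have hM := hsame.mem rM (by simp)
    have hW' := hsame.mem rW (by simp)
    have hE := hsame.mem rE (by simp)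
    have hz : s'.mem rZ + s'.mem rPw *
        flag ((s'.mem rS / s'.mem rM * s'.mem rE + s'.mem rS) % s'.mem rM < s'.mem rT) =
        keptSum (s.mem rM) (s.mem rW) (s.mem rY) (k + 1) (s.mem rE) := by
      rw [keptSum, Finset.sum_range_succ, ← keptSum, hZ, hpw, hS, hM, hE, hT]
      change _ + _ * flag (Kept _ _ _ _) = _
      by_cases h : Kept (s.mem rM) (threshold (s.mem rM) k) (s.mem rY / (s.mem rM ^ 2) ^ k)
          (s.mem rE)
      · rw [if_pos h, flag_of h, mul_one]
      · rw [if_neg h, flag_of_not h, mul_zero]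
    have hpow : ∀ i ≤ s.mem rK, (s.mem rW ^ 3) ^ i < 2 ^ L := fun i hi =>
      (Nat.pow_le_pow_right (by positivity) hi).trans_lt hL
    refine .of_fits fun hs' => ?_
    refine .assign_seq (by norm_num) ?_ ?_
    · simp only [Arith.eval_add, Arith.eval_mul, Arith.eval_reg, Arith.eval_less, Arith.eval_mod,
        Arith.eval_div]
      rw [hz]
      exact (keptSum_lt hW).trans (hpow _ hkK)
    refine .assign_seq (by norm_num) ?_ ?_
    · simp only [Arith.eval_mul, Arith.eval_reg, Arith.eval_power, Config.write_mem]
      simp only [Nat.reduceEqDiff, if_false, hpw, hW', ← pow_succ]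
      exact hpow _ hkK
    refine .assign_seq (by norm_num) ?_ ?_
    · simp only [Arith.eval_div, Arith.eval_reg, Arith.eval_power, Config.write_mem]
      simp only [Nat.reduceEqDiff, if_false]
      exact (Nat.div_le_self _ _).trans_lt (hs'.lt _)
    have hthr : s'.mem rT / 2 + s'.mem rM * (1 - s'.mem rT / 2) = threshold (s.mem rM) (k + 1) := by
      rw [hT, hM, threshold]
    refine .assign_seq (by norm_num) ?_ ?_
    · simp only [Arith.eval_add, Arith.eval_sub, Arith.eval_mul, Arith.eval_div, Arith.eval_ofNat,
        Arith.eval_reg, Config.write_mem, Nat.reduceEqDiff, if_false, hthr]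
      exact (threshold_le _ _).trans_lt (hs.lt _)
    refine .assign (by norm_num) ?_ ?_
    · simp only [Arith.eval_sub, Arith.eval_ofNat, Arith.eval_reg, Config.write_mem,
        Nat.reduceEqDiff, if_false]
      exact (Nat.sub_le _ _).trans_lt (hs'.lt _)
    · refine ⟨⟨k + 1, hkK, ?_, ?_, ?_, ?_, ?_, ?_⟩, ?_⟩
      · simp [hc]; omega
      · simp [hpw, hW', pow_succ]
      · simp [hS, hM, pow_succ, Nat.div_div_eq_div_mul]
      · simp only [Arith.eval_add, Arith.eval_sub, Arith.eval_mul, Arith.eval_div, Arith.eval_ofNat,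
          Arith.eval_reg, Config.write_mem, Nat.reduceEqDiff, if_false, hthr, if_true]
      · simp only [Arith.eval_add, Arith.eval_sub, Arith.eval_mul, Arith.eval_div, Arith.eval_ofNat,
          Arith.eval_mod, Arith.eval_less,
          Arith.eval_reg, Config.write_mem, Nat.reduceEqDiff, if_false, hz, if_true]
      · exact ((((hsame.write (by simp)).write (by simp)).write (by simp)).write (by simp)).write
          (by simp)
      · simp; omega
  · rintro s' - ⟨⟨k, hk, hc, -, -, -, hZ, hsame⟩, h0⟩
    simp only [Arith.eval_reg] at h0
    obtain rfl : k = s.mem rK := by omega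
    exact ⟨hZ, hsame⟩

end Samplers

/-! ### Reading the stream -/

section Stream

variable {n L : ℕ}

/-- The code of the pair of the values of `x` and `y`. -/
def Arith.pair (x y : Arith) : Arith := (x - (x - y)) * reg rN + (x + (y - x))

@[simp] lemma Arith.eval_pair (m : Mem) (x y : Arith) :
    (x.pair y).eval m = pairCode (m rN) (x.eval m) (y.eval m) := by
  simp only [Arith.pair, Arith.eval_add, Arith.eval_mul, Arith.eval_sub, Arith.eval_reg, pairCode]
  congr 1
  · congr 1
    omega
  · omega

/-- The moments of the key in `rE`. -/
def keyMoments : Arith := 1 + reg rE * reg rW + (reg rE).power 2 * (reg rW).power 2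

@[simp] lemma eval_keyMoments (m : Mem) : keyMoments.eval m = moments (m rW) (m rE) := by
  simp [keyMoments, moments]

/-- Read the next update into `rKind`, `rU`, `rV`. -/
def readUpdate : Program := .next (.const rKind) (.const rU) (.const rV)

/-- Read the whole stream and compute the sketch in `rA`. In `rKind`, `1` stands for an
insertion and `2` for a deletion. -/
def processStream : Program :=
  readUpdate;;
  .loop (reg rKind)
    (rE <~ (reg rU).pair (reg rV);;
      runSamplers;;
      rA <~ reg rA + (2 - reg rKind) * (keyMoments * reg rZ) -
        (reg rKind - 1) * (keyMoments * reg rZ);;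
      readUpdate)

/-- The updates `ρ` are still to be processed, the first of them being in the registers. -/
def Pending (s : Config n) : List (Update n) → Prop
  | [] => s.mem rKind = 0
  | t :: ρ => s.mem rKind = (if t.ins then 1 else 2) ∧ s.mem rU = t.u ∧ s.mem rV = t.v ∧
      s.input = ρ

lemma ensures_readUpdate {s : Config n} (h2 : 2 < 2 ^ L) (hn : n ≤ 2 ^ L) :
    Ensures L readUpdate s fun s' => Pending s' s.input ∧
      (∀ r, r ∉ [rKind, rU, rV] → s'.mem r = s.mem r) ∧ s'.coins = s.coins ∧
      s'.output = s.output ∧ s'.input.length + min 1 (s'.mem rKind) = s.input.length := by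
  intro hs
  refine ⟨_, .next _ _ _ s, ?_⟩
  simp only [Arith.eval]
  rcases hi : s.input with _ | ⟨t, ρ⟩
  · have he : s.next rKind rU rV = ((s.write rKind 0).write rU 0).write rV 0 := by
      simp only [Config.next, hi]
    rw [he]
    refine ⟨((hs.write (by norm_num) (by omega)).write (by norm_num) (by omega)).write
      (by norm_num) (by omega), ?_, ?_, rfl, rfl, ?_⟩
    · simp [Pending]
    · intro r hr
      simp only [List.mem_cons, List.not_mem_nil, or_false, not_or] at hr
      simp [hr]
    · simp [hi]
  · have he : s.next rKind rU rV = ((({ s with input := ρ } : Config n).write rKind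
        (if t.ins then 1 else 2)).write rU t.u).write rV t.v := by
      simp only [Config.next, hi]
    rw [he]
    have h1 : Fits L ({ s with input := ρ } : Config n) := ⟨hs.1, hs.2, hs.3⟩
    refine ⟨((h1.write (by norm_num) (by split_ifs <;> omega)).write (by norm_num)
      (by omega)).write (by norm_num) (by omega), ?_, ?_, rfl, rfl, ?_⟩
    · simp [Pending]
    · intro r hr
      simp only [List.mem_cons, List.not_mem_nil, or_false, not_or] at hr
      simp [hr]
    · simp only [Config.write_input, Config.write_mem, Nat.reduceEqDiff, if_true, if_false,
        List.length_cons]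
      split_ifs <;> omega

lemma ensures_processStream {a : ℕ} {s : Config n} (h2 : 2 < 2 ^ L) (hn1 : 1 ≤ n)
    (hn2 : n ^ 2 ≤ 2 ^ L) (hN : s.mem rN = n) (hW : s.mem rW = n ^ (a + 6) + 1) (hA : s.mem rA = 0)
    (hL : (s.mem rW ^ 3) ^ s.mem rK < 2 ^ L)
    (hB : ∀ τ, τ <+: s.input → ∀ e,
      0 ≤ edgeMultiplicity τ e ∧ edgeMultiplicity τ e ≤ (n ^ a : ℕ)) :
    Ensures L processStream s fun s' =>
      IsSketch (s.mem rM) (s.mem rW) (s.mem rY) (s.mem rK) s.input (s'.mem rA) ∧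
      (∀ r, r ∉ [rA, rKind, rU, rV, rC, rPw, rS, rT, rZ, rE] → s'.mem r = s.mem r) ∧
      s'.coins = s.coins ∧ s'.output = s.output := by
  refine .of_fits fun hs => ?_
  have hn : n < 2 ^ L := hN ▸ hs.lt rN
  refine .seq ((ensures_readUpdate h2 hn.le).mono fun s₁ _ h₁ => ?_)
  obtain ⟨hp₁, hm₁, hc₁, ho₁, -⟩ := h₁
  refine (Ensures.loop (fun s' => ∃ τ ρ, τ ++ ρ = s.input ∧ Pending s' ρ ∧
      IsSketch (s.mem rM) (s.mem rW) (s.mem rY) (s.mem rK) τ (s'.mem rA) ∧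
      (∀ r, r ∉ [rA, rKind, rU, rV, rC, rPw, rS, rT, rZ, rE] → s'.mem r = s.mem r) ∧
      s'.coins = s.coins ∧ s'.output = s.output)
    (fun s' => s'.input.length + min 1 (s'.mem rKind)) ?_ ?_).mono ?_
  · refine ⟨[], s.input, rfl, hp₁, ?_, fun r hr => hm₁ r fun h => hr ?_, hc₁, ho₁⟩
    · rw [hm₁ rA (by simp), hA]
      exact isSketch_nil _ _ _ _
    · simp only [List.mem_cons, List.not_mem_nil, or_false] at h ⊢
      tauto
  · rintro s' ⟨τ, ρ, hτ, hp, hsk, hm, hc, ho⟩ hne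
    simp only [Arith.eval_reg] at hne
    rcases ρ with _ | ⟨t, ρ⟩
    · exact absurd hp hne
    obtain ⟨hk, hu, hv, hin⟩ := hp
    have hM' := hm rM (by simp)
    have hK' := hm rK (by simp)
    have hW' := hm rW (by simp)
    have hY' := hm rY (by simp)
    have hN' := hm rN (by simp)
    have hW2 : 2 ≤ s.mem rW := by
      rw [hW]
      have := Nat.one_le_pow (a + 6) n hn1
      omega
    have hcode : pairCode n t.u t.v < n ^ 2 := edgeCode_lt t.edge
    have hsk' := hsk.append_singleton t fun e => (hB (τ ++ [t]) ⟨ρ, by rw [← hτ]; simp⟩ e).1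
    have hlt : ∀ τ' A', τ' <+: s.input → IsSketch (s.mem rM) (s.mem rW) (s.mem rY) (s.mem rK)
        τ' A' → A' < 2 ^ L := by
      intro τ' A' hτ' hA'
      rw [hW] at hA' hL
      exact (hA'.lt hn1 (fun e => (hB τ' hτ' e).1) (fun e => (hB τ' hτ' e).2)).trans hL
    refine .assign_seq (by norm_num) ?_ ?_
    · simpa [hN', hN, hu, hv] using hcode.trans_le hn2
    refine .seq ((ensures_runSamplers ?_ ?_).mono fun s₂ _ h₂ => ?_)
    · simpa [hW'] using hW2
    · simpa [hW', hK'] using hL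
    obtain ⟨hz, hsame⟩ := h₂
    have hE₂ : s₂.mem rE = edgeCode t.edge := by
      rw [hsame.mem rE (by simp)]
      simp [hN', hN, hu, hv, Update.edge]
    have hz₂ : keyMoments.eval s₂.mem * s₂.mem rZ =
        sketchWeight (s.mem rM) (s.mem rW) (s.mem rY) (s.mem rK) t := by
      rw [eval_keyMoments, hE₂, hz, sketchWeight, hsame.mem rW (by simp)]
      simp [hM', hW', hY', hK', hN', hN, hu, hv, Update.edge]
    have hval : Arith.eval s₂.mem (reg rA + (2 - reg rKind) * (keyMoments * reg rZ) -
        (reg rKind - 1) * (keyMoments * reg rZ)) =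
        if t.ins then s'.mem rA + sketchWeight (s.mem rM) (s.mem rW) (s.mem rY) (s.mem rK) t
        else s'.mem rA - sketchWeight (s.mem rM) (s.mem rW) (s.mem rY) (s.mem rK) t := by
      simp only [Arith.eval_add, Arith.eval_sub, Arith.eval_mul, Arith.eval_ofNat, Arith.eval_reg,
        hz₂, hsame.mem rA (by simp), hsame.mem rKind (by simp), Config.write_mem,
        Nat.reduceEqDiff, if_false, hk]
      split_ifs <;> simp
    refine .assign_seq (by norm_num) ?_ ?_
    · rw [hval]
      exact hlt _ _ ⟨ρ, by rw [← hτ]; simp⟩ hsk'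
    rw [hval]
    refine (ensures_readUpdate h2 hn.le).mono fun s₃ _ h₃ => ?_
    obtain ⟨hp₃, hm₃, hc₃, ho₃, hl₃⟩ := h₃
    have hin₂ : s₂.input = ρ := by rw [hsame.input]; simpa using hin
    rw [Config.write_input, hin₂] at hp₃ hl₃
    refine ⟨⟨τ ++ [t], ρ, by rw [← hτ]; simp, hp₃, ?_, ?_, ?_, ?_⟩, ?_⟩
    · rw [hm₃ rA (by simp)]
      simpa using hsk'
    · intro r hr
      simp only [List.mem_cons, List.not_mem_nil, or_false, not_or] at hr
      rw [hm₃ r (by simp; tauto), Config.write_mem, if_neg hr.1, hsame.mem r (by simp; tauto),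
        Config.write_mem, if_neg (by tauto)]
      exact hm r (by simp; tauto)
    · rw [hc₃, Config.write_coins, hsame.coins]
      simpa using hc
    · rw [ho₃, Config.write_output, hsame.output]
      simpa using ho
    · rw [hl₃, hin]
      omega
  · rintro s' - ⟨⟨τ, ρ, hτ, hp, hsk, hm, hc, ho⟩, h0⟩
    simp only [Arith.eval_reg] at h0
    rcases ρ with _ | ⟨t, ρ⟩
    · rw [List.append_nil] at hτ
      subst hτ
      exact ⟨hsk, hm, hc, ho⟩
    · have := hp.1
      split_ifs at this <;> omega

end Stream

/-! ### Searching for a longest path -/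

section Search

variable {n L : ℕ}

/-- A list of vertices, shifted by one so that they are nonzero digits in base `n + 1`, that
forms a path in the graph recovered from the sketch. -/
structure IsCodedPath (n W K A : ℕ) (l : List ℕ) : Prop where
  nodup : l.Nodup
  zero_notMem : 0 ∉ l
  isChain : l.IsChain fun v w => Recovers W K A (pairCode n (v - 1) (w - 1))

lemma isCodedPath_nil (n W K A : ℕ) : IsCodedPath n W K A [] := ⟨by simp, by simp, by simp⟩

lemma isCodedPath_cons {n W K A v : ℕ} {l : List ℕ} : IsCodedPath n W K A (v :: l) ↔
    v ≠ 0 ∧ v ∉ l ∧ (∀ w ∈ l.head?, Recovers W K A (pairCode n (v - 1) (w - 1))) ∧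
      IsCodedPath n W K A l := by
  constructor
  · rintro ⟨h1, h2, h3⟩
    rw [List.nodup_cons] at h1
    rw [List.isChain_cons] at h3
    simp only [List.mem_cons, not_or] at h2
    exact ⟨fun h => h2.1 h.symm, h1.1, h3.1, h1.2, h2.2, h3.2⟩
  · rintro ⟨h1, h2, h3, h4⟩
    refine ⟨List.nodup_cons.2 ⟨h2, h4.nodup⟩, ?_, List.isChain_cons.2 ⟨h3, h4.isChain⟩⟩
    simp only [List.mem_cons, not_or]
    exact ⟨h1.symm, h4.zero_notMem⟩

/-- Compute in `rG` a nonzero number if and only if the sketch recovers the key in `rE`. -/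
def recoverLoop : Program :=
  rG <~ 0;; rC <~ reg rK;; rS <~ reg rA;;
  .loop (reg rC)
    (rG <~ reg rG + (reg rS % (reg rW).power 3).nonzero *
        (1 - ((reg rS % (reg rW).power 3).differ
          (reg rS % (reg rW).power 3 % reg rW * keyMoments)));;
      rS <~ reg rS / (reg rW).power 3;;
      rC <~ reg rC - 1)

lemma ensures_recoverLoop {s : Config n} :
    Ensures L recoverLoop s fun s' =>
      (s'.mem rG ≠ 0 ↔ Recovers (s.mem rW) (s.mem rK) (s.mem rA) (s.mem rE)) ∧
        SameExcept [rG, rC, rS] s s' := by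
  refine .of_fits fun hs => ?_
  refine .assign_seq (by norm_num) (by simp) ?_
  refine .assign_seq (by norm_num) (by simpa using hs.lt _) ?_
  refine .assign_seq (by norm_num) (by simpa using hs.lt _) ?_
  refine (Ensures.loop (fun s' => ∃ k ≤ s.mem rK, s'.mem rC = s.mem rK - k ∧
      s'.mem rS = s.mem rA / (s.mem rW ^ 3) ^ k ∧ s'.mem rG ≤ k ∧
      (s'.mem rG ≠ 0 ↔ Recovers (s.mem rW) k (s.mem rA) (s.mem rE)) ∧
      SameExcept [rG, rC, rS] s s') (fun s' => s'.mem rC) ?_ ?_).mono ?_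
  · refine ⟨0, Nat.zero_le _, by simp, by simp, by simp, by simp [Recovers], ?_⟩
    exact ((SameExcept.refl.write (by simp)).write (by simp)).write (by simp)
  · rintro s' ⟨k, hk, hc, hS, hG, hR, hsame⟩ hne
    simp only [Arith.eval_reg] at hne
    have hkK : k < s.mem rK := by omega
    have hW := hsame.mem rW (by simp)
    have hE := hsame.mem rE (by simp)
    have hval : (reg rG + (reg rS % (reg rW).power 3).nonzero *
        (1 - ((reg rS % (reg rW).power 3).differ
          (reg rS % (reg rW).power 3 % reg rW * keyMoments)))).eval s'.mem =
        s'.mem rG + flag (Detects (s.mem rW)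
          (s.mem rA / (s.mem rW ^ 3) ^ k % s.mem rW ^ 3) (s.mem rE)) := by
      simp only [Arith.eval_add, Arith.eval_mul, Arith.eval_nonzero, Arith.eval_sub,
        Arith.eval_differ, Arith.eval_mod, Arith.eval_power, Arith.eval_reg, Arith.eval_ofNat,
        eval_keyMoments, hS, hW, hE]
      congr 1
      generalize s.mem rA / (s.mem rW ^ 3) ^ k % s.mem rW ^ 3 = d
      by_cases h1 : d ≠ 0
      · by_cases h2 : d = d % s.mem rW * moments (s.mem rW) (s.mem rE)
        · rw [flag_of h1, flag_of_not (not_not.2 h2), flag_of (show Detects _ _ _ from ⟨h1, h2⟩)]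
        · rw [flag_of h1, flag_of h2, flag_of_not fun h : Detects _ _ _ => h2 h.2]
      · rw [flag_of_not h1, flag_of_not fun h : Detects _ _ _ => h1 h.1, zero_mul]
    have hfl := flag_le_one (Detects (s.mem rW)
          (s.mem rA / (s.mem rW ^ 3) ^ k % s.mem rW ^ 3) (s.mem rE))
    refine .of_fits fun hs' => ?_
    have hKL := hs.lt rK
    refine .assign_seq (by norm_num) (by rw [hval]; omega) ?_
    rw [hval]
    refine .assign_seq (by norm_num) ?_ ?_
    · simp only [Arith.eval_div, Arith.eval_reg, Arith.eval_power, Config.write_mem,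
        Nat.reduceEqDiff, if_false]
      exact (Nat.div_le_self _ _).trans_lt (hs'.lt _)
    refine .assign (by norm_num) ?_ ?_
    · simp only [Arith.eval_sub, Arith.eval_ofNat, Arith.eval_reg, Config.write_mem,
        Nat.reduceEqDiff, if_false]
      exact (Nat.sub_le _ _).trans_lt (hs'.lt _)
    · refine ⟨⟨k + 1, hkK, ?_, ?_, ?_, ?_, ?_⟩, ?_⟩
      · simp [hc]; omega
      · simp [hS, hW, pow_succ, Nat.div_div_eq_div_mul]
      · simp; omega
      · simp only [Config.write_mem, Nat.reduceEqDiff, if_false, if_true]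
        have h1 : Recovers (s.mem rW) (k + 1) (s.mem rA) (s.mem rE) ↔
            Recovers (s.mem rW) k (s.mem rA) (s.mem rE) ∨ Detects (s.mem rW)
              (s.mem rA / (s.mem rW ^ 3) ^ k % s.mem rW ^ 3) (s.mem rE) := by
          constructor
          · rintro ⟨i, hi, hd⟩
            rcases Nat.lt_succ_iff_lt_or_eq.1 hi with h | rfl
            · exact .inl ⟨i, h, hd⟩
            · exact .inr hd
          · rintro (⟨i, hi, hd⟩ | hd)
            · exact ⟨i, by omega, hd⟩
            · exact ⟨k, by omega, hd⟩
        rw [h1, ← hR, ne_eq, Nat.add_eq_zero_iff, not_and_or, ← ne_eq, ← ne_eq, flag_ne_zero]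
      · exact ((hsame.write (by simp)).write (by simp)).write (by simp)
      · simp; omega
  · rintro s' - ⟨⟨k, hk, hc, -, -, hR, hsame⟩, h0⟩
    simp only [Arith.eval_reg] at h0
    obtain rfl : k = s.mem rK := by omega
    exact ⟨hR, hsame⟩

/-- Reset `rOk` if the digit in `rV` is among those of the number in `rX`. -/
def distinctLoop : Program :=
  rS <~ reg rX;;
  .loop (reg rS)
    (rOk <~ reg rOk * (reg rS % (reg rN + 1)).differ (reg rV);;
      rS <~ reg rS / (reg rN + 1))

lemma ensures_distinctLoop {s : Config n} (hn : 1 ≤ s.mem rN) (hOk : s.mem rOk ≤ 1) :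
    Ensures L distinctLoop s fun s' => s'.mem rOk ≤ 1 ∧
      (s'.mem rOk ≠ 0 ↔
        s.mem rOk ≠ 0 ∧ s.mem rV ∉ Nat.digits (s.mem rN + 1) (s.mem rX)) ∧
      SameExcept [rOk, rS] s s' := by
  refine .of_fits fun hs => ?_
  refine .assign_seq (by norm_num) (by simpa using hs.lt _) ?_
  refine (Ensures.loop (fun s' => s'.mem rOk ≤ 1 ∧ s'.mem rS ≤ s.mem rX ∧
      ((s'.mem rOk ≠ 0 ∧ s.mem rV ∉ Nat.digits (s.mem rN + 1) (s'.mem rS)) ↔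
        s.mem rOk ≠ 0 ∧ s.mem rV ∉ Nat.digits (s.mem rN + 1) (s.mem rX)) ∧
      SameExcept [rOk, rS] s s') (fun s' => s'.mem rS) ?_ ?_).mono ?_
  · exact ⟨by simpa using hOk, by simp, by simp, SameExcept.refl.write (by simp)⟩
  · rintro s' ⟨hle, hxs, hiff, hsame⟩ hne
    simp only [Arith.eval_reg] at hne
    have hN := hsame.mem rN (by simp)
    have hV := hsame.mem rV (by simp)
    have hfl := flag_le_one (s'.mem rS % (s.mem rN + 1) ≠ s.mem rV)
    have hval : (reg rOk * (reg rS % (reg rN + 1)).differ (reg rV)).eval s'.mem =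
        s'.mem rOk * flag (s'.mem rS % (s.mem rN + 1) ≠ s.mem rV) := by
      simp only [Arith.eval_mul, Arith.eval_reg, Arith.eval_differ, Arith.eval_mod,
        Arith.eval_add, Arith.eval_ofNat, hN, hV]
    have hle' : s'.mem rOk * flag (s'.mem rS % (s.mem rN + 1) ≠ s.mem rV) ≤ 1 :=
      Nat.mul_le_mul hle hfl
    have hL : 1 < 2 ^ L := lt_of_le_of_lt hn (hs.lt _)
    refine .assign_seq (by norm_num) (by rw [hval]; omega) ?_
    rw [hval]
    have hdiv : s'.mem rS / (s.mem rN + 1) < s'.mem rS :=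
      Nat.div_lt_self (Nat.pos_of_ne_zero hne) (by omega)
    refine .assign (by norm_num) ?_ ?_
    · simp only [Arith.eval_div, Arith.eval_add, Arith.eval_ofNat, Arith.eval_reg, Config.write_mem,
        Nat.reduceEqDiff, if_false, hN]
      exact hdiv.trans (hxs.trans_lt (hs.lt _))
    · refine ⟨⟨by simpa using hle', ?_, ?_, (hsame.write (by simp)).write (by simp)⟩, ?_⟩
      · simpa [hN] using hdiv.le.trans hxs
      · rw [← hiff, Nat.digits_def' (n := s'.mem rS) (by omega) (Nat.pos_of_ne_zero hne)]
        simp only [Config.write_mem, Nat.reduceEqDiff, if_false, if_true, Arith.eval_div,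
          Arith.eval_add, Arith.eval_ofNat, Arith.eval_reg, hN, List.mem_cons, not_or,
          Nat.mul_ne_zero_iff, flag_ne_zero]
        tauto
      · simpa [hN] using hdiv
  · rintro s' - ⟨⟨hle, -, hiff, hsame⟩, h0⟩
    simp only [Arith.eval_reg] at h0
    refine ⟨hle, ?_, hsame⟩
    simpa [h0] using hiff

/-- Check in `rOk` whether the digits of the number in `rP` form a path. -/
def checkPath : Program :=
  rOk <~ 1;; rX <~ reg rP;;
  .loop (reg rX)
    (rV <~ reg rX % (reg rN + 1);;
      rX <~ reg rX / (reg rN + 1);;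
      rOk <~ reg rOk * (reg rV).nonzero;;
      distinctLoop;;
      .ite (reg rX)
        (rE <~ (reg rV - 1).pair (reg rX % (reg rN + 1) - 1);;
          recoverLoop;;
          rOk <~ reg rOk * (reg rG).nonzero)
        .skip)

lemma ensures_checkPath {s : Config n} (hN : s.mem rN = n) (hn1 : 1 ≤ n) (hn2 : n ^ 2 ≤ 2 ^ L) :
    Ensures L checkPath s fun s' =>
      (s'.mem rOk ≠ 0 ↔ IsCodedPath n (s.mem rW) (s.mem rK) (s.mem rA)
        (Nat.digits (n + 1) (s.mem rP))) ∧
      s'.mem rOk ≤ 1 ∧ SameExcept [rOk, rX, rV, rS, rE, rG, rC] s s' := by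
  refine .of_fits fun hs => ?_
  have hL : 1 < 2 ^ L := lt_of_le_of_lt hn1 (hN ▸ hs.lt rN)
  refine .assign_seq (by norm_num) (by simpa using hL) ?_
  refine .assign_seq (by norm_num) (by simpa using hs.lt _) ?_
  refine (Ensures.loop (fun s' => s'.mem rOk ≤ 1 ∧
      ((s'.mem rOk ≠ 0 ∧ IsCodedPath n (s.mem rW) (s.mem rK) (s.mem rA)
        (Nat.digits (n + 1) (s'.mem rX))) ↔
        IsCodedPath n (s.mem rW) (s.mem rK) (s.mem rA) (Nat.digits (n + 1) (s.mem rP))) ∧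
      SameExcept [rOk, rX, rV, rS, rE, rG, rC] s s') (fun s' => s'.mem rX) ?_ ?_).mono ?_
  · exact ⟨by simp, by simp, (SameExcept.refl.write (by simp)).write (by simp)⟩
  · rintro s' ⟨hle, hiff, hsame⟩ hne
    simp only [Arith.eval_reg] at hne
    have hN' := (hsame.mem rN (by simp)).trans hN
    have hdig := Nat.digits_def' (b := n + 1) (by omega) (Nat.pos_of_ne_zero hne)
    rw [hdig, isCodedPath_cons] at hiff
    have hdiv : s'.mem rX / (n + 1) < s'.mem rX :=
      Nat.div_lt_self (Nat.pos_of_ne_zero hne) (by omega)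
    refine .of_fits fun hs' => ?_
    refine .assign_seq (by norm_num) ?_ ?_
    · simp only [Arith.eval_mod, Arith.eval_reg, Arith.eval_add, Arith.eval_ofNat]
      exact (Nat.mod_le _ _).trans_lt (hs'.lt _)
    refine .assign_seq (by norm_num) ?_ ?_
    · simp only [Arith.eval_div, Arith.eval_reg, Arith.eval_add, Arith.eval_ofNat,
        Config.write_mem, Nat.reduceEqDiff, if_false]
      exact (Nat.div_le_self _ _).trans_lt (hs'.lt _)
    have hfl := flag_le_one (s'.mem rX % (n + 1) ≠ 0)
    have hle' : s'.mem rOk * flag (s'.mem rX % (n + 1) ≠ 0) ≤ 1 := Nat.mul_le_mul hle hfl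
    simp only [Arith.eval_mod, Arith.eval_div, Arith.eval_reg, Arith.eval_add, Arith.eval_ofNat,
        Config.write_mem, Nat.reduceEqDiff, if_false, hN']
    refine .assign_seq (by norm_num) ?_ ?_
    · simp only [Arith.eval_mul, Arith.eval_reg, Arith.eval_nonzero,
        Config.write_mem, Nat.reduceEqDiff, if_false, if_true]
      omega
    simp only [Arith.eval_mul, Arith.eval_reg, Arith.eval_nonzero, Config.write_mem,
      Nat.reduceEqDiff, if_false, if_true]
    refine .seq ((ensures_distinctLoop ?_ ?_).mono fun s₁ _ h₁ => ?_)
    · simpa [hN'] using hn1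
    · simpa using hle'
    obtain ⟨hle₁, hok₁, hsame₁⟩ := h₁
    simp only [Config.write_mem, Nat.reduceEqDiff, if_false, if_true, hN', OfNat.zero_ne_ofNat,
      Nat.mul_ne_zero_iff, flag_ne_zero] at hok₁
    have hX₁ : s₁.mem rX = s'.mem rX / (n + 1) := by rw [hsame₁.mem rX (by simp)]; simp
    have hV₁ : s₁.mem rV = s'.mem rX % (n + 1) := by rw [hsame₁.mem rV (by simp)]; simp
    have hsame₂ : SameExcept [rOk, rX, rV, rS, rE, rG, rC] s s₁ :=
      (((hsame.write (by simp)).write (by simp)).write (by simp)).trans hsame₁ (by simp)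
    have hN₁ := (hsame₂.mem rN (by simp)).trans hN
    refine .ite (fun hx => ?_) (fun hx => ?_)
    · simp only [Arith.eval_reg, hX₁] at hx
      have hdig' := Nat.digits_def' (b := n + 1) (by omega) (Nat.pos_of_ne_zero hx)
      have hmod : ∀ y, y % (n + 1) - 1 < n := fun y => by
        have := Nat.mod_lt y (Nat.succ_pos n)
        simp only [Nat.succ_eq_add_one] at this
        omega
      refine .assign_seq (by norm_num) ?_ ?_
      · simp only [Arith.eval_pair, Arith.eval_sub, Arith.eval_mod, Arith.eval_add, Arith.eval_reg,
          Arith.eval_ofNat, hN₁, hX₁, hV₁]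
        exact (edgeCode_lt s(⟨_, hmod (s'.mem rX)⟩, ⟨_, hmod (s'.mem rX / (n + 1))⟩)).trans_le hn2
      simp only [Arith.eval_pair, Arith.eval_sub, Arith.eval_mod, Arith.eval_add, Arith.eval_reg,
          Arith.eval_ofNat, hN₁, hX₁, hV₁]
      refine .seq (ensures_recoverLoop.mono fun s₂ _ h₂ => ?_)
      obtain ⟨hR, hsame₃⟩ := h₂
      simp only [Config.write_mem, Nat.reduceEqDiff, if_false, if_true,
        hsame₂.mem rW (by simp), hsame₂.mem rK (by simp), hsame₂.mem rA (by simp)] at hR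
      have hOk₂ : s₂.mem rOk = s₁.mem rOk := by rw [hsame₃.mem rOk (by simp)]; simp
      have hX₂ : s₂.mem rX = s₁.mem rX := by rw [hsame₃.mem rX (by simp)]; simp
      have hfl₂ := flag_le_one (s₂.mem rG ≠ 0)
      have hle₂ : s₂.mem rOk * flag (s₂.mem rG ≠ 0) ≤ 1 :=
        Nat.mul_le_mul (hOk₂ ▸ hle₁) hfl₂
      refine .assign (by norm_num) ?_ ?_
      · simp only [Arith.eval_mul, Arith.eval_reg, Arith.eval_nonzero]
        omega
      · refine ⟨⟨by simpa using hle₂, ?_, ?_⟩, ?_⟩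
        · rw [← hiff]
          simp only [Config.write_mem, Nat.reduceEqDiff, if_false, if_true, Arith.eval_mul,
            Arith.eval_reg, Arith.eval_nonzero, Nat.mul_ne_zero_iff, flag_ne_zero, hOk₂, hX₂, hX₁,
            hok₁, hR]
          rw [hdig']
          simp only [List.head?_cons, Option.mem_def, Option.some.injEq, forall_eq']
          tauto
        · exact ((hsame₂.write (by simp)).trans hsame₃ (by simp)).write (by simp)
        · simp only [Config.write_mem, Nat.reduceEqDiff, if_false, hX₂, hX₁]
          exact hdiv
    · simp only [Arith.eval_reg, hX₁] at hx
      refine .skip ⟨⟨hle₁, ?_, hsame₂⟩, ?_⟩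
      · rw [← hiff, hX₁, hok₁, hx]
        simp [isCodedPath_nil]
      · rw [hX₁]
        exact hdiv
  · rintro s' - ⟨⟨hle, hiff, hsame⟩, h0⟩
    simp only [Arith.eval_reg] at h0
    refine ⟨?_, hle, hsame⟩
    rw [h0] at hiff
    simpa [isCodedPath_nil] using hiff

/-- Find in `rP` the largest number below the one in `rD` whose digits form a path. A path with
more vertices has a larger code, so this is a longest path. -/
def searchPath : Program :=
  rP <~ reg rD;; rOk <~ 0;;
  .loop (1 - reg rOk) (rP <~ reg rP - 1;; checkPath)

/-- The single vertex `0` is a path, so the search ends before `rP` reaches `0`. -/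
lemma isCodedPath_digits_one {W K A : ℕ} (hn1 : 1 ≤ n) :
    IsCodedPath n W K A (Nat.digits (n + 1) 1) := by
  rw [Nat.digits_of_lt _ _ one_ne_zero (by omega)]
  exact ⟨by simp, by simp, by simp⟩

lemma ensures_searchPath {s : Config n} (hN : s.mem rN = n) (hn1 : 1 ≤ n) (hn2 : n ^ 2 ≤ 2 ^ L)
    (hD : 1 < s.mem rD) :
    Ensures L searchPath s fun s' =>
      0 < s'.mem rP ∧ IsCodedPath n (s.mem rW) (s.mem rK) (s.mem rA)
        (Nat.digits (n + 1) (s'.mem rP)) ∧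
      (∀ p < s.mem rD, IsCodedPath n (s.mem rW) (s.mem rK) (s.mem rA) (Nat.digits (n + 1) p) →
        p ≤ s'.mem rP) ∧
      SameExcept [rP, rOk, rX, rV, rS, rE, rG, rC] s s' := by
  refine .of_fits fun hs => ?_
  refine .assign_seq (by norm_num) (by simpa using hs.lt _) ?_
  refine .assign_seq (by norm_num) (by simp) ?_
  refine (Ensures.loop (fun s' => s'.mem rOk ≤ 1 ∧ 0 < s'.mem rP ∧
      (s'.mem rOk ≠ 0 → IsCodedPath n (s.mem rW) (s.mem rK) (s.mem rA)
        (Nat.digits (n + 1) (s'.mem rP))) ∧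
      (∀ p < s.mem rD, IsCodedPath n (s.mem rW) (s.mem rK) (s.mem rA) (Nat.digits (n + 1) p) →
        p ≤ s'.mem rP ∧ (s'.mem rOk = 0 → p < s'.mem rP)) ∧
      SameExcept [rP, rOk, rX, rV, rS, rE, rG, rC] s s') (fun s' => s'.mem rP) ?_ ?_).mono ?_
  · refine ⟨by simp, ?_, by simp, fun p hp _ => ?_,
      (SameExcept.refl.write (by simp)).write (by simp)⟩
    · simp; omega
    · simp; omega
  · rintro s' ⟨hle, hpos, hok, hmax, hsame⟩ hne
    simp only [Arith.eval_sub, Arith.eval_ofNat, Arith.eval_reg] at hne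
    have hok0 : s'.mem rOk = 0 := by omega
    have h1 := (hmax 1 hD (isCodedPath_digits_one hn1)).2 hok0
    refine .of_fits fun hs' => ?_
    refine .assign_seq (by norm_num) ?_ ?_
    · simp only [Arith.eval_sub, Arith.eval_reg, Arith.eval_ofNat]
      exact (Nat.sub_le _ _).trans_lt (hs'.lt _)
    simp only [Arith.eval_sub, Arith.eval_reg, Arith.eval_ofNat]
    refine (ensures_checkPath ?_ hn1 hn2).mono fun s₁ _ h₁ => ?_
    · simp [hsame.mem rN (by simp), hN]
    obtain ⟨hiff, hle₁, hsame₁⟩ := h₁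
    simp only [Config.write_mem, Nat.reduceEqDiff, if_false, if_true,
      hsame.mem rW (by simp), hsame.mem rK (by simp), hsame.mem rA (by simp)] at hiff
    have hP₁ : s₁.mem rP = s'.mem rP - 1 := by rw [hsame₁.mem rP (by simp)]; simp
    refine ⟨⟨hle₁, by omega, ?_, fun p hp hc => ?_, ?_⟩, by omega⟩
    · rw [hP₁]
      exact hiff.1
    · have h2 := (hmax p hp hc).2 hok0
      refine ⟨by omega, fun h0 => ?_⟩
      refine lt_of_le_of_ne (by omega) fun heq => ?_
      rw [heq, hP₁] at hc
      exact hiff.2 hc h0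
    · exact (hsame.write (by simp)).trans hsame₁ (by simp)
  · rintro s' - ⟨⟨hle, hpos, hok, hmax, hsame⟩, h0⟩
    simp only [Arith.eval_sub, Arith.eval_ofNat, Arith.eval_reg] at h0
    exact ⟨hpos, hok (by omega), fun p hp hc => (hmax p hp hc).1, hsame⟩

/-- Write out the path whose code is in `rP`. -/
def emitPath : Program :=
  .loop (reg rP) (.emit (reg rP % (reg rN + 1) - 1);; rP <~ reg rP / (reg rN + 1))

lemma ensures_emitPath {s : Config n} (hN : s.mem rN = n) (hn1 : 1 ≤ n) :
    Ensures L emitPath s fun s' =>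
      s'.output = s.output ++ (Nat.digits (n + 1) (s.mem rP)).map (· - 1) := by
  refine (Ensures.loop (fun s' => s'.mem rN = n ∧
      s'.output ++ (Nat.digits (n + 1) (s'.mem rP)).map (· - 1) =
        s.output ++ (Nat.digits (n + 1) (s.mem rP)).map (· - 1)) (fun s' => s'.mem rP)
      ⟨hN, rfl⟩ ?_).mono ?_
  · rintro s' ⟨hN', hout⟩ hne
    simp only [Arith.eval_reg] at hne
    have hdig := Nat.digits_def' (b := n + 1) (by omega) (Nat.pos_of_ne_zero hne)
    have hdiv : s'.mem rP / (n + 1) < s'.mem rP :=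
      Nat.div_lt_self (Nat.pos_of_ne_zero hne) (by omega)
    refine .of_fits fun hs' => ?_
    refine .seq (.emit ?_)
    refine .assign (by norm_num) ?_ ?_
    · simp only [Arith.eval_div, Arith.eval_reg, Arith.eval_add, Arith.eval_ofNat]
      exact (Nat.div_le_self _ _).trans_lt (hs'.lt _)
    · refine ⟨⟨by simpa using hN', ?_⟩, ?_⟩
      · rw [← hout, hdig]
        simp [hN']
      · simpa [hN'] using hdiv
  · rintro s' - ⟨⟨-, hout⟩, h0⟩
    simp only [Arith.eval_reg] at h0
    rw [← hout, h0]
    simp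

end Search

/-! ### The algorithm -/

section Algorithm

variable {n L : ℕ}

/-- The modulus of the hash functions is `2 ^ modulusLog n`. It is large enough for the threshold
of the right level to exceed all keys, which are below `n ^ 2`. -/
def modulusLog (n : ℕ) : ℕ := Nat.clog 2 (16 * n ^ 4)

/-- The number of samplers of each level. As `2 * 95 ^ 96 ≤ 96 ^ 96`, the probability that they all
miss a fixed set is at most `2 ^ (-(n + c) * (modulusLog n + 1)) ≤ n ^ (-(n + c))`. -/
def samplersPerLevel (n c : ℕ) : ℕ := 96 * ((n + c) * (modulusLog n + 1))

/-- The total number of samplers. -/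
def samplerCount (n c : ℕ) : ℕ := (modulusLog n + 1) * samplersPerLevel n c

/-- The number of coins that are flipped: two numbers below the modulus for each sampler. -/
def coinCount (n c : ℕ) : ℕ := 2 * modulusLog n * samplerCount n c

/-- An upper bound for the number of bits of a register. -/
def registerSize (n c a : ℕ) : ℕ :=
  (2 * modulusLog n + 3 * (n ^ (a + 6) + 1).size) * samplerCount n c + 1

/-- Compute the modulus in `rM` and the number of levels in `rLev`. -/
def computeModulus : Program :=
  rM <~ 1;; rLev <~ 1;;
  .loop (16 * (reg rN).power 4 - reg rM) (rM <~ 2 * reg rM;; rLev <~ reg rLev + 1)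

/-- Compute the number of samplers in `rK` and the base of the sketch in `rW`. -/
def computeParameters (c a : ℕ) : Program :=
  rK <~ reg rLev * (96 * ((reg rN + .const c) * reg rLev));;
  rW <~ (reg rN).power (a + 6) + 1

/-- Flip as many coins as all samplers together need, and store them as one number in `rY`;
the number of possible outcomes is computed in `rD`. -/
def drawSeeds : Program :=
  rD <~ 1;; rC <~ 2 * (reg rLev - 1) * reg rK;;
  .loop (reg rC)
    (.flip (.const rB);;
      rY <~ 2 * reg rY + reg rB;;
      rD <~ 2 * reg rD;;
      rC <~ reg rC - 1)

/-- The semi-streaming algorithm. -/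
def longPathProgram (c a : ℕ) : Program :=
  computeModulus;; computeParameters c a;; drawSeeds;; processStream;; searchPath;; emitPath

lemma ensures_computeModulus {s : Config n} (hN : s.mem rN = n)
    (hL : 2 ^ modulusLog n < 2 ^ L) (hL' : modulusLog n + 1 < 2 ^ L) :
    Ensures L computeModulus s fun s' => s'.mem rM = 2 ^ modulusLog n ∧
      s'.mem rLev = modulusLog n + 1 ∧ SameExcept [rM, rLev] s s' := by
  have h1 : 1 < 2 ^ L := lt_of_le_of_lt (by omega) hL'
  refine .assign_seq (by norm_num) h1 ?_
  refine .assign_seq (by norm_num) h1 ?_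
  refine (Ensures.loop (fun s' => ∃ i ≤ modulusLog n, s'.mem rM = 2 ^ i ∧
    s'.mem rLev = i + 1 ∧ SameExcept [rM, rLev] s s')
    (fun s' => 16 * n ^ 4 - s'.mem rM) ?_ ?_).mono ?_
  · exact ⟨0, Nat.zero_le _, by simp, by simp, (SameExcept.refl.write (by simp)).write (by simp)⟩
  · rintro s' ⟨i, hi, hM, hLev, hsame⟩ hne
    have hN' := (hsame.mem rN (by simp)).trans hN
    simp only [Arith.eval_sub, Arith.eval_mul, Arith.eval_ofNat, Arith.eval_power, Arith.eval_reg,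
      hN', hM] at hne
    have hi' : i < modulusLog n := by
      refine lt_of_le_of_ne hi fun h => hne ?_
      rw [h]
      exact Nat.sub_eq_zero_of_le (Nat.le_pow_clog one_lt_two _)
    have hpow : 2 * 2 ^ i ≤ 2 ^ modulusLog n := by
      rw [← pow_succ']
      exact Nat.pow_le_pow_right two_pos hi'
    have hpos : 0 < 2 ^ i := by positivity
    refine .assign_seq (by norm_num) ?_ ?_
    · simp only [Arith.eval_mul, Arith.eval_ofNat, Arith.eval_reg, hM]
      omega
    refine .assign (by norm_num) ?_ ?_
    · simp [hLev]; omega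
    · refine ⟨⟨i + 1, hi', ?_, ?_, (hsame.write (by simp)).write (by simp)⟩, ?_⟩
      · simp [hM, pow_succ']
      · simp [hLev]
      · simp only [Config.write_mem, Nat.reduceEqDiff, if_false, if_true, Arith.eval_mul,
          Arith.eval_ofNat, Arith.eval_reg, hM]
        omega
  · rintro s' - ⟨⟨i, hi, hM, hLev, hsame⟩, h0⟩
    have hN' := (hsame.mem rN (by simp)).trans hN
    simp only [Arith.eval_sub, Arith.eval_mul, Arith.eval_ofNat, Arith.eval_power, Arith.eval_reg,
      hN', hM] at h0
    have : modulusLog n ≤ i := Nat.clog_le_of_le_pow (Nat.le_of_sub_eq_zero h0)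
    obtain rfl : i = modulusLog n := le_antisymm hi this
    exact ⟨hM, hLev, hsame⟩

lemma ensures_drawSeeds {s : Config n} {t K : ℕ} (hLev : s.mem rLev = t + 1) (hK : s.mem rK = K)
    (hY : s.mem rY = 0) (hL : 2 * t * K < L) :
    Ensures L drawSeeds s fun s' => s'.mem rY = coinValue s.coins (2 * t * K) ∧
      s'.mem rD = 2 ^ (2 * t * K) ∧ (∀ r, r ∉ [rY, rD, rC, rB] → s'.mem r = s.mem r) ∧
      s'.input = s.input ∧ s'.output = s.output := by
  have h1 : 1 < 2 ^ L := Nat.one_lt_two_pow (by omega)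
  have hpow : 2 ^ (2 * t * K) < 2 ^ L := Nat.pow_lt_pow_right one_lt_two hL
  refine .assign_seq (by norm_num) h1 ?_
  refine .assign_seq (by norm_num) ?_ ?_
  · simp only [Arith.eval_sub, Arith.eval_mul, Arith.eval_ofNat, Arith.eval_reg, Config.write_mem,
      Nat.reduceEqDiff, if_false, hLev, hK, Nat.add_sub_cancel]
    exact Nat.lt_two_pow_self.trans hpow
  refine (Ensures.loop (fun s' => ∃ i ≤ 2 * t * K, s'.mem rC = 2 * t * K - i ∧
    s'.mem rY = coinValue s.coins i ∧ s'.mem rD = 2 ^ i ∧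
    s'.coins = (fun j => s.coins (j + i)) ∧
    (∀ r, r ∉ [rY, rD, rC, rB] → s'.mem r = s.mem r) ∧
      s'.input = s.input ∧ s'.output = s.output) (fun s' => s'.mem rC) ?_ ?_).mono ?_
  · refine ⟨0, Nat.zero_le _, by simp [hLev, hK], by simp [hY, coinValue], by simp, by simp,
      fun r hr => ?_, rfl, rfl⟩
    simp only [List.mem_cons, List.not_mem_nil, or_false, not_or] at hr
    simp [hr]
  · rintro s' ⟨i, hi, hC, hY', hD, hco, hm, hin, hout⟩ hne
    simp only [Arith.eval_reg] at hne
    have hi' : i + 1 ≤ 2 * t * K := by omega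
    have hpow' : 2 ^ (i + 1) < 2 ^ L :=
      (Nat.pow_le_pow_right two_pos hi').trans_lt hpow
    have hmem : ∀ r, (s'.flip rB).mem r = if r = rB then (s.coins i).toNat else s'.mem r := by
      intro r
      simp [Config.flip, Config.write, Function.update_apply, hco]
    have hval : 2 * coinValue s.coins i + (s.coins i).toNat = coinValue s.coins (i + 1) := rfl
    have hC' := Nat.lt_two_pow_self (n := 2 * t * K)
    refine .seq (.flip (by norm_num) (by omega) ?_)
    refine .assign_seq (by norm_num) ?_ ?_
    · simp only [Arith.eval_add, Arith.eval_mul, Arith.eval_ofNat, Arith.eval_reg, hmem,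
        Nat.reduceEqDiff, if_false, if_true, hY', hval]
      exact (coinValue_lt _ _).trans hpow'
    refine .assign_seq (by norm_num) ?_ ?_
    · simp only [Arith.eval_mul, Arith.eval_ofNat, Arith.eval_reg, Config.write_mem, hmem,
        Nat.reduceEqDiff, if_false, hD, ← pow_succ']
      exact hpow'
    refine .assign (by norm_num) ?_ ?_
    · simp only [Arith.eval_sub, Arith.eval_ofNat, Arith.eval_reg, Config.write_mem, hmem,
        Nat.reduceEqDiff, if_false, hC]
      omega
    · refine ⟨⟨i + 1, hi', ?_, ?_, ?_, ?_, fun r hr => ?_, hin, hout⟩, ?_⟩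
      · simp [hmem, hC]; omega
      · simp [hmem, hY', coinValue]
      · simp [hmem, hD, pow_succ']
      · simp [Config.flip, hco, add_assoc, add_comm 1]
      · simp only [List.mem_cons, List.not_mem_nil, or_false, not_or] at hr
        simp only [Config.write_mem, hmem, if_neg hr.1, if_neg hr.2.1, if_neg hr.2.2.1,
          if_neg hr.2.2.2]
        exact hm r (by simp; tauto)
      · simp [hmem]; omega
  · rintro s' - ⟨⟨i, hi, hC, hY', hD, hco, hm, hin, hout⟩, h0⟩
    simp only [Arith.eval_reg] at h0
    obtain rfl : i = 2 * t * K := by omega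
    exact ⟨hY', hD, hm, hin, hout⟩

lemma le_samplerCount {n : ℕ} (c : ℕ) (hn : 1 ≤ n) : n + modulusLog n + 1 ≤ samplerCount n c := by
  rw [samplerCount, samplersPerLevel]
  generalize modulusLog n = t
  nlinarith [Nat.zero_le (t * n), Nat.zero_le (t * c), Nat.zero_le (t * t * n),
    Nat.zero_le (t * t * c), Nat.zero_le (c), Nat.mul_le_mul_left t hn]

/-- What a run of the algorithm on the stream `σ` with the coins `ω` outputs: the longest path
of the graph recovered from the sketch. -/
structure IsRunResult {n : ℕ} (c a : ℕ) (σ : List (Update n)) (ω : ℕ → Bool) (A p : ℕ)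
    (out : List ℕ) : Prop where
  sketch : IsSketch (2 ^ modulusLog n) (n ^ (a + 6) + 1) (coinValue ω (coinCount n c))
    (samplerCount n c) σ A
  pos : 0 < p
  coded : IsCodedPath n (n ^ (a + 6) + 1) (samplerCount n c) A (Nat.digits (n + 1) p)
  max : ∀ q < 2 ^ coinCount n c,
    IsCodedPath n (n ^ (a + 6) + 1) (samplerCount n c) A (Nat.digits (n + 1) q) → q ≤ p
  output : out = (Nat.digits (n + 1) p).map (· - 1)

lemma ensures_longPathProgram {c a : ℕ} (hn : 1 ≤ n) {σ : List (Update n)} (ω : ℕ → Bool)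
    (hB : ∀ τ, τ <+: σ → ∀ e, 0 ≤ edgeMultiplicity τ e ∧ edgeMultiplicity τ e ≤ (n ^ a : ℕ)) :
    Ensures (registerSize n c a) (longPathProgram c a) (initial σ ω) fun s' =>
      ∃ A p, IsRunResult c a σ ω A p s'.output := by
  have hK0 := le_samplerCount c hn
  have hNdef : coinCount n c = 2 * modulusLog n * samplerCount n c := rfl
  have hLdef : registerSize n c a = 2 * modulusLog n * samplerCount n c +
      3 * (n ^ (a + 6) + 1).size * samplerCount n c + 1 := by rw [registerSize, add_mul]
  set t := modulusLog n with ht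
  set K := samplerCount n c with hK
  set W := n ^ (a + 6) + 1 with hW
  set L := registerSize n c a with hL
  have hn6 := Nat.one_le_pow (a + 6) n hn
  have hsize : 1 ≤ W.size := Nat.size_pos.2 (by omega)
  have hWK : (W ^ 3) ^ K < 2 ^ L := by
    calc (W ^ 3) ^ K ≤ ((2 ^ W.size) ^ 3) ^ K :=
          Nat.pow_le_pow_left (Nat.pow_le_pow_left (Nat.lt_size_self W).le 3) K
      _ = 2 ^ (3 * W.size * K) := by rw [← pow_mul, ← pow_mul]; ring_nf
      _ < 2 ^ L := Nat.pow_lt_pow_right one_lt_two (by omega)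
  have hWL : W < 2 ^ L := by
    refine lt_of_le_of_lt ?_ hWK
    rw [← pow_mul]
    exact Nat.le_self_pow (by omega) W
  have hKL : K < L := by
    have := Nat.mul_le_mul_right K (show 1 ≤ 3 * W.size by omega)
    omega
  have hKL' : K < 2 ^ L := hKL.trans Nat.lt_two_pow_self
  have htL : 2 ^ t < 2 ^ L := Nat.pow_lt_pow_right one_lt_two (by omega)
  have hn2 : n ^ 2 ≤ 2 ^ L := by
    have : n ^ 2 ≤ n ^ (a + 6) := Nat.pow_le_pow_right hn (by omega)
    omega
  have h2 : 2 < 2 ^ L := by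
    calc 2 < 2 ^ 2 := by norm_num
      _ ≤ 2 ^ L := Nat.pow_le_pow_right two_pos (by omega)
  have hN0 : (initial σ ω).mem rN = n := by simp [initial]
  have h0 : ∀ r, r ≠ 0 → (initial σ ω).mem r = 0 := fun r hr => by
    simp [initial, hr.symm]
  refine .seq ((ensures_computeModulus hN0 htL (by omega)).mono fun s₁ _ h₁ => ?_)
  obtain ⟨hM₁, hLev₁, hs₁⟩ := h₁
  rw [← ht] at hM₁ hLev₁
  have hN₁ := (hs₁.mem rN (by simp)).trans hN0
  have hKval : (t + 1) * (96 * ((n + c) * (t + 1))) = K := rfl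
  refine .seq (.assign_seq (by norm_num) ?_ (.assign (by norm_num) ?_ ?_))
  · simpa [hLev₁, hN₁, hKval] using hKL'
  · simpa [hN₁] using hWL
  set s₂ := (s₁.write rK _).write rW _ with hs₂
  have hK₂ : s₂.mem rK = K := by simp [hs₂, hLev₁, hN₁, hKval]
  have hW₂ : s₂.mem rW = W := by simp [hs₂, hN₁, hW]
  have hm₂ : ∀ r, r ≠ 3 → r ≠ 4 → s₂.mem r = s₁.mem r := fun r h3 h4 => by simp [hs₂, h3, h4]
  have hin₂ : s₂.input = σ := hs₁.input
  have hco₂ : s₂.coins = ω := hs₁.coins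
  have hout₂ : s₂.output = [] := hs₁.output
  clear_value s₂
  refine .seq ((ensures_drawSeeds (t := t) (K := K) ?_ hK₂ ?_ (by omega)).mono fun s₃ _ h₃ => ?_)
  · rw [hm₂ _ (by norm_num) (by norm_num), hLev₁]
  · rw [hm₂ _ (by norm_num) (by norm_num), hs₁.mem rY (by simp), h0 _ (by norm_num)]
  obtain ⟨hY₃, hD₃, hm₃, hin₃, hout₃⟩ := h₃
  rw [hco₂, ← hNdef] at hY₃
  rw [← hNdef] at hD₃
  rw [hin₂] at hin₃
  rw [hout₂] at hout₃
  have hN₃ : s₃.mem rN = n := by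
    rw [hm₃ _ (by simp), hm₂ _ (by norm_num) (by norm_num), hN₁]
  have hM₃ : s₃.mem rM = 2 ^ t := by
    rw [hm₃ _ (by simp), hm₂ _ (by norm_num) (by norm_num), hM₁]
  have hA₃ : s₃.mem rA = 0 := by
    rw [hm₃ _ (by simp), hm₂ _ (by norm_num) (by norm_num), hs₁.mem rA (by simp),
      h0 _ (by norm_num)]
  have hK₃ : s₃.mem rK = K := by rw [hm₃ _ (by simp), hK₂]
  have hW₃ : s₃.mem rW = W := by rw [hm₃ _ (by simp), hW₂]
  refine .seq ((ensures_processStream (a := a) h2 hn hn2 hN₃ hW₃ hA₃ ?_ ?_).mono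
    fun s₄ _ h₄ => ?_)
  · rwa [hW₃, hK₃]
  · rwa [hin₃]
  obtain ⟨hsk₄, hm₄, -, hout₄⟩ := h₄
  rw [hM₃, hW₃, hY₃, hK₃, hin₃] at hsk₄
  have hN₄ : s₄.mem rN = n := by rw [hm₄ _ (by simp), hN₃]
  have hD₄ : s₄.mem rD = 2 ^ coinCount n c := by rw [hm₄ _ (by simp), hD₃]
  refine .seq ((ensures_searchPath hN₄ hn hn2 ?_).mono fun s₅ _ h₅ => ?_)
  · rw [hD₄]
    refine Nat.one_lt_two_pow ?_
    have ht0 : 0 < t := Nat.clog_pos one_lt_two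
      ((show 2 ≤ 16 * 1 by norm_num).trans (Nat.mul_le_mul_left 16 (Nat.one_le_pow _ _ hn)))
    rw [hNdef]
    have : 0 < K := by omega
    positivity
  obtain ⟨hp, hcoded, hmax, hs₅⟩ := h₅
  rw [hm₄ rW (by simp), hW₃, hm₄ rK (by simp), hK₃] at hcoded hmax
  rw [hD₄] at hmax
  refine (ensures_emitPath ((hs₅.mem rN (by simp)).trans hN₄) hn).mono fun s₆ _ h₆ => ?_
  rw [hs₅.output, hout₄, hout₃, List.nil_append] at h₆
  exact ⟨_, _, hsk₄, hp, hcoded, hmax, h₆⟩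

end Algorithm

/-! ### Correctness of the output -/

section Output

variable {n : ℕ}

lemma exists_map_add_one_eq {l : List ℕ} (h : ∀ v ∈ l, v < n + 1) (h0 : 0 ∉ l) :
    ∃ l' : List (Fin n), l'.map (fun i : Fin n => (i : ℕ) + 1) = l := by
  induction l with
  | nil => exact ⟨[], rfl⟩
  | cons v l ih =>
    simp only [List.mem_cons, not_or] at h0
    obtain ⟨l', hl'⟩ := ih (fun w hw => h w (List.mem_cons_of_mem _ hw)) h0.2
    have hv := h v List.mem_cons_self
    refine ⟨⟨v - 1, by omega⟩ :: l', ?_⟩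
    rw [List.map_cons, hl']
    congr 1
    simp only
    omega

/-- The support of a path of the recovered graph is a list counted by `IsCodedPath`. -/
lemma isCodedPath_support {W K A : ℕ} {u v : Fin n} {q : (recoveredGraph n W K A).Walk u v}
    (hq : q.IsPath) : IsCodedPath n W K A (q.support.map fun i : Fin n => (i : ℕ) + 1) := by
  refine ⟨?_, by simp, ?_⟩
  · exact hq.support_nodup.map fun i j h => Fin.ext (by simpa using h)
  · rw [List.isChain_map]
    exact q.isChain_adj_support.imp fun x y h => h.2

variable {c a : ℕ} {σ : List (Update n)} {ω : ℕ → Bool} {A p : ℕ} {out : List ℕ}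
  {G : SimpleGraph (Fin n)}

lemma pow_le_two_pow_coinCount (hn : 1 ≤ n) : (n + 1) ^ n ≤ 2 ^ coinCount n c := by
  have h1 : n + 1 ≤ 2 ^ modulusLog n :=
    le_trans (by nlinarith [Nat.le_self_pow (show 4 ≠ 0 by norm_num) n])
      (Nat.le_pow_clog one_lt_two (16 * n ^ 4))
  have h2 := le_samplerCount c hn
  calc (n + 1) ^ n ≤ (2 ^ modulusLog n) ^ n := Nat.pow_le_pow_left h1 n
    _ = 2 ^ (modulusLog n * n) := (pow_mul _ _ _).symm
    _ ≤ 2 ^ coinCount n c := by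
        refine Nat.pow_le_pow_right two_pos ?_
        rw [coinCount, mul_assoc, mul_comm 2, mul_assoc]
        exact Nat.mul_le_mul_left _ (by omega)

/-- The output is at least as long as every path of the recovered graph. -/
lemma IsRunResult.length_le (h : IsRunResult c a σ ω A p out) (hn : 1 ≤ n) {u v : Fin n}
    (q : (recoveredGraph n (n ^ (a + 6) + 1) (samplerCount n c) A).Walk u v) (hq : q.IsPath) :
    q.length + 1 ≤ out.length := by
  set l := q.support.map fun i : Fin n => (i : ℕ) + 1 with hl
  have hlt : ∀ v ∈ l, v < n + 1 := by
    intro v hv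
    obtain ⟨i, -, rfl⟩ := List.mem_map.1 hv
    simp
  have hdig : Nat.digits (n + 1) (Nat.ofDigits (n + 1) l) = l := by
    refine Nat.digits_ofDigits _ (by omega) _ hlt fun hne h0 => ?_
    have := List.getLast_mem hne
    rw [h0] at this
    exact (isCodedPath_support hq).zero_notMem this
  have hlen : l.length ≤ n := by
    rw [hl, List.length_map]
    simpa using hq.support_nodup.length_le_card
  have hD : Nat.ofDigits (n + 1) l < 2 ^ coinCount n c := by
    refine (Nat.ofDigits_lt_base_pow_length (by omega) hlt).trans_le ?_
    exact (Nat.pow_le_pow_right (by omega) hlen).trans (pow_le_two_pow_coinCount hn)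
  have hle := h.max _ hD (by rw [hdig]; exact isCodedPath_support hq)
  have := Nat.le_length_digits_le (n + 1) _ _ hle
  rw [hdig] at this
  rw [h.output, List.length_map]
  refine le_trans ?_ this
  rw [hl, List.length_map, SimpleGraph.Walk.length_support]

/-- The output is a path of the graph that the stream describes. -/
lemma IsRunResult.isPath (h : IsRunResult c a σ ω A p out) (hn : 1 ≤ n)
    (hσ : IsInsertionDeletionStream (n ^ a) G σ) {ℓ : ℝ} (hℓ : ℓ + 1 ≤ out.length) :
    IsPathOfLengthAtLeast G ℓ out := by
  obtain ⟨l', hl'⟩ := exists_map_add_one_eq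
    (fun v hv => Nat.digits_lt_base (by omega) hv) h.coded.zero_notMem
  have hne : l' ≠ [] := by
    rintro rfl
    have := Nat.digits_ne_nil_iff_ne_zero (b := n + 1) |>.2 h.pos.ne'
    exact this hl'.symm
  have hcoded := h.coded
  rw [← hl'] at hcoded
  have hnodup : l'.Nodup := hcoded.nodup.of_map
  have hB := hσ.2.1 σ (List.prefix_refl σ)
  have hadj : ∀ x y : Fin n, Recovers (n ^ (a + 6) + 1) (samplerCount n c) A
      (pairCode n x y) → G.Adj x y := by
    intro x y hr
    rw [← SimpleGraph.mem_edgeSet, hσ.2.2]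
    exact h.sketch.pos_of_recovers hn (fun e => (hB e).1) (fun e => (hB e).2) (e := s(x, y)) hr
  have hchain : l'.IsChain G.Adj := by
    have := hcoded.isChain
    rw [List.isChain_map] at this
    exact this.imp fun x y hr => hadj x y (by simpa using hr)
  have hout : l'.map Fin.val = out := by
    rw [h.output, ← hl', List.map_map]
    rfl
  refine ⟨_, _, SimpleGraph.Walk.ofSupport l' hne hchain, ?_, ?_, ?_⟩
  · rw [SimpleGraph.Walk.isPath_def, SimpleGraph.Walk.support_ofSupport]
    exact hnodup
  · rw [SimpleGraph.Walk.support_ofSupport, hout]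
  · rw [← hout, List.length_map] at hℓ
    have h1 := SimpleGraph.Walk.length_support (SimpleGraph.Walk.ofSupport l' hne hchain)
    rw [SimpleGraph.Walk.support_ofSupport] at h1
    rw [h1] at hℓ
    push_cast at hℓ
    linarith

end Output

/-! ### The probability of success -/

section Probability

variable {n : ℕ} (G : SimpleGraph (Fin n))

/-- The codes of the edges of `G`. -/
noncomputable def edgeCodes : Finset ℕ := by
  classical exact G.edgeFinset.image edgeCode

lemma mem_edgeCodes {G : SimpleGraph (Fin n)} {k : ℕ} :
    k ∈ edgeCodes G ↔ ∃ e ∈ G.edgeSet, edgeCode e = k := by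
  simp [edgeCodes]

lemma card_edgeCodes : (edgeCodes G).card = G.edgeSet.ncard := by
  classical
  rw [edgeCodes, Finset.card_image_of_injective _ edgeCode_injective,
    ← SimpleGraph.coe_edgeFinset, Set.ncard_coe_finset]

/-- The largest number `ℓ` with `3 n ℓ < 2 |E|`: if the longest path is shorter than a third of
the average degree, then its length is at most `ℓ`. -/
noncomputable def lengthBound : ℕ := (2 * (edgeCodes G).card - 1) / (3 * n)

/-- The codes of those edges of `G` that are not covered by a forest of depth at most
`lengthBound G` with parent function `f`. -/
noncomputable def crossingCodes (f : Fin n → Fin n) : Finset ℕ :=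
  edgeCodes G \ (ancestorPairs f (lengthBound G)).image edgeCode

lemma crossingCodes_subset (f : Fin n → Fin n) : crossingCodes G f ⊆ edgeCodes G :=
  Finset.sdiff_subset

lemma card_edgeCodes_le_crossingCodes (hE : 0 < (edgeCodes G).card) (f : Fin n → Fin n) :
    (edgeCodes G).card ≤ 3 * (crossingCodes G f).card := by
  have h1 : (edgeCodes G).card - n * lengthBound G ≤ (crossingCodes G f).card := by
    refine le_trans ?_ (Finset.le_card_sdiff _ _)
    refine Nat.sub_le_sub_left (Finset.card_image_le.trans ?_) _
    simpa using card_ancestorPairs_le f (lengthBound G)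
  have h2 : 3 * n * lengthBound G ≤ 2 * (edgeCodes G).card - 1 := Nat.mul_div_le _ _
  have h3 : 3 * n * lengthBound G = 3 * (n * lengthBound G) := mul_assoc _ _ _
  omega

/-- The outcomes of the coins for which, for some parent function `f`, no sampler isolates an
edge that the forest does not cover. -/
noncomputable def badSeeds (c : ℕ) : Finset ℕ := by
  classical
  exact (Finset.range (((2 ^ modulusLog n) ^ 2) ^ samplerCount n c)).filter fun Y =>
      ∃ X ∈ Finset.univ.image (crossingCodes G), ∀ k < samplerCount n c, ∀ e ∈ X,
        ¬ Isolates (2 ^ modulusLog n) (threshold (2 ^ modulusLog n) k) (edgeCodes G)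
            (Y / ((2 ^ modulusLog n) ^ 2) ^ k) e

lemma two_pow_coinCount (n c : ℕ) :
    ((2 ^ modulusLog n) ^ 2) ^ samplerCount n c = 2 ^ coinCount n c := by
  rw [← pow_mul, ← pow_mul, coinCount]
  ring_nf

/-- `(95 / 96) ^ 96 ≤ 1 / 2`. -/
lemma two_pow_mul_pow_le (q : ℕ) : 2 ^ q * 95 ^ (96 * q) ≤ 96 ^ (96 * q) := by
  rw [pow_mul, pow_mul, ← mul_pow]
  exact Nat.pow_le_pow_left (by norm_num) q

lemma card_badSeeds_mul_le (c : ℕ) (hn : 1 ≤ n) (hE : 0 < (edgeCodes G).card) :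
    (badSeeds G c).card * n ^ c ≤ 2 ^ coinCount n c := by
  classical
  have hcard : (edgeCodes G).card ≤ n ^ 2 := by
    have : edgeCodes G ⊆ Finset.range (n ^ 2) := by
      intro k hk
      obtain ⟨e, -, rfl⟩ := mem_edgeCodes.1 hk
      simpa using edgeCode_lt e
    simpa using Finset.card_le_card this
  have hpow : 16 * n ^ 4 ≤ 2 ^ modulusLog n := Nat.le_pow_clog one_lt_two _
  have h1 := card_seeds_missing_le (N := n ^ 2) (t := modulusLog n) (Q := samplersPerLevel n c)
    (E := edgeCodes G) (fun k hk => by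
      obtain ⟨e, -, rfl⟩ := mem_edgeCodes.1 hk
      exact (edgeCode_lt e).le) hE
    (le_trans (by nlinarith [Nat.mul_le_mul_right (n ^ 2) hcard]) hpow)
    (Nat.one_le_pow _ _ hn) (F := Finset.univ.image (crossingCodes G))
    (fun X hX => by
      obtain ⟨f, -, rfl⟩ := Finset.mem_image.1 hX
      exact crossingCodes_subset G f)
    (fun X hX => by
      obtain ⟨f, -, rfl⟩ := Finset.mem_image.1 hX
      exact card_edgeCodes_le_crossingCodes G hE f)
  have h2 : (badSeeds G c).card * 96 ^ samplersPerLevel n c ≤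
      (Finset.univ.image (crossingCodes G)).card * 95 ^ samplersPerLevel n c *
        2 ^ coinCount n c := by
    rw [← two_pow_coinCount]
    refine le_trans (le_of_eq ?_) h1
    simp only [badSeeds, samplerCount]
    congr!
  have hF : (Finset.univ.image (crossingCodes G)).card ≤ n ^ n := by
    refine Finset.card_image_le.trans ?_
    simp
  have h3 : n ^ n * n ^ c * 95 ^ samplersPerLevel n c ≤ 96 ^ samplersPerLevel n c := by
    refine le_trans (Nat.mul_le_mul_right _ ?_) (two_pow_mul_pow_le ((n + c) * (modulusLog n + 1)))
    rw [← pow_add, mul_comm (n + c), pow_mul]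
    refine Nat.pow_le_pow_left ?_ _
    have : n ≤ 16 * n ^ 4 := by nlinarith [Nat.le_self_pow (show 4 ≠ 0 by norm_num) n]
    exact this.trans (hpow.trans (Nat.pow_le_pow_right two_pos (Nat.le_succ _)))
  have h96 : 0 < 96 ^ samplersPerLevel n c := by positivity
  refine Nat.le_of_mul_le_mul_right ?_ h96
  calc (badSeeds G c).card * n ^ c * 96 ^ samplersPerLevel n c
      = n ^ c * ((badSeeds G c).card * 96 ^ samplersPerLevel n c) := by ring
    _ ≤ n ^ c * (n ^ n * 95 ^ samplersPerLevel n c * 2 ^ coinCount n c) :=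
        Nat.mul_le_mul_left _ (h2.trans (Nat.mul_le_mul_right _ (Nat.mul_le_mul_right _ hF)))
    _ = n ^ n * n ^ c * 95 ^ samplersPerLevel n c * 2 ^ coinCount n c := by ring
    _ ≤ 96 ^ samplersPerLevel n c * 2 ^ coinCount n c := Nat.mul_le_mul_right _ h3
    _ = _ := mul_comm _ _

variable {c a : ℕ} {σ : List (Update n)} {ω : ℕ → Bool} {A p : ℕ} {out : List ℕ} {G}

/-- If the seed is not bad, then the recovered graph has a long path. Otherwise all its edges
would be ancestor pairs of a forest of small depth, although it has an edge which is none. -/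
lemma exists_long_path (h : IsRunResult c a σ ω A p out) (hn : 1 ≤ n)
    (hσ : IsInsertionDeletionStream (n ^ a) G σ)
    (hgood : coinValue ω (coinCount n c) ∉ badSeeds G c) :
    ∃ (u v : Fin n) (q : (recoveredGraph n (n ^ (a + 6) + 1) (samplerCount n c) A).Walk u v),
      q.IsPath ∧ lengthBound G < q.length := by
  by_contra hcon
  push Not at hcon
  obtain ⟨f, hf⟩ := exists_edgeSet_subset_ancestorPairs _ (lengthBound G) hcon
  refine hgood ?_
  rw [badSeeds, Finset.mem_filter, Finset.mem_range, two_pow_coinCount]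
  refine ⟨coinValue_lt _ _, _, Finset.mem_image_of_mem _ (Finset.mem_univ f), ?_⟩
  intro k hk x hx hi
  rw [crossingCodes, Finset.mem_sdiff] at hx
  obtain ⟨e, he, rfl⟩ := mem_edgeCodes.1 hx.1
  refine hx.2 (Finset.mem_image_of_mem _ (hf e ?_))
  have hB := hσ.2.1 σ (List.prefix_refl σ)
  refine mem_edgeSet_recoveredGraph (G.not_isDiag_of_mem_edgeSet he) ?_
  exact h.sketch.recovers hn (fun e => (hB e).1) (fun e => (hB e).2)
    (fun g hg => mem_edgeCodes.2 ⟨g, (hσ.2.2 g).2 hg, rfl⟩) ((hσ.2.2 e).1 he) hk hi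

lemma averageDegree_div_three_le (G : SimpleGraph (Fin n)) (hn : 1 ≤ n) :
    averageDegree G / 3 ≤ lengthBound G + 1 := by
  have h1 := Nat.lt_mul_div_succ (2 * (edgeCodes G).card - 1) (show 0 < 3 * n by omega)
  have h2 : 2 * (edgeCodes G).card ≤ 3 * n * (lengthBound G + 1) := by
    rw [lengthBound]
    omega
  have hn' : (0 : ℝ) < n := by exact_mod_cast hn
  have h3 : 2 * ((edgeCodes G).card : ℝ) ≤ 3 * n * (lengthBound G + 1) := by exact_mod_cast h2
  rw [averageDegree, ← card_edgeCodes, div_div, div_le_iff₀ (by positivity)]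
  linarith

lemma le_outputProb (c : ℕ) (hn : 1 ≤ n) (hσ : IsInsertionDeletionStream (n ^ a) G σ)
    (hrun : ∀ ω, ∃ s, Exec (longPathProgram c a) (initial σ ω) s ∧
      ∃ A p, IsRunResult c a σ ω A p s.output) :
    1 - 1 / (n : ℝ) ^ c ≤
      outputProb (longPathProgram c a) σ (IsPathOfLengthAtLeast G (averageDegree G / 3)) := by
  have hn' : (0 : ℝ) < n := by exact_mod_cast hn
  rcases Nat.eq_zero_or_pos (edgeCodes G).card with hE | hE
  -- without edges the average degree is `0`, and a single vertex will do
  · have hall : ∀ ω ∈ (Set.univ : Set (ℕ → Bool)), ω ∈ {ω | ∃ s,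
        Exec (longPathProgram c a) (initial σ ω) s ∧
          IsPathOfLengthAtLeast G (averageDegree G / 3) s.output} := by
      intro ω _
      obtain ⟨s, hex, A, p, h⟩ := hrun ω
      refine ⟨s, hex, h.isPath hn hσ ?_⟩
      have h1 := h.length_le hn (SimpleGraph.Walk.nil (u := ⟨0, hn⟩)) (by simp)
      have h2 : averageDegree G = 0 := by
        rw [averageDegree, ← card_edgeCodes, hE]
        simp
      rw [h2]
      have h3 : (1 : ℝ) ≤ s.output.length := by exact_mod_cast h1
      linarith
    have h1 : coinMeasure.real Set.univ ≤ outputProb (longPathProgram c a) σ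
        (IsPathOfLengthAtLeast G (averageDegree G / 3)) := measureReal_mono hall
    rw [probReal_univ] at h1
    have : 0 ≤ 1 / (n : ℝ) ^ c := by positivity
    linarith
  have hbad := card_badSeeds_mul_le G c hn hE
  have hsub : badSeeds G c ⊆ Finset.range (2 ^ coinCount n c) := by
    rw [badSeeds, two_pow_coinCount]
    exact Finset.filter_subset _ _
  have h1 : ((Finset.range (2 ^ coinCount n c) \ badSeeds G c).card : ℝ) / 2 ^ coinCount n c ≤
      outputProb (longPathProgram c a) σ (IsPathOfLengthAtLeast G (averageDegree G / 3)) := by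
    refine le_coinMeasure (fun y hy => by simpa using (Finset.mem_sdiff.1 hy).1) fun ω hω => ?_
    obtain ⟨s, hex, A, p, h⟩ := hrun ω
    refine ⟨s, hex, h.isPath hn hσ ?_⟩
    obtain ⟨u, v, q, hq, hlen⟩ := exists_long_path h hn hσ (Finset.mem_sdiff.1 hω).2
    have h1 := h.length_le hn q hq
    have h2 : ((lengthBound G + 1 + 1 : ℕ) : ℝ) ≤ s.output.length := by
      exact_mod_cast (by omega : lengthBound G + 1 + 1 ≤ s.output.length)
    push_cast at h2
    linarith [averageDegree_div_three_le G hn]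
  refine le_trans ?_ h1
  rw [Finset.card_sdiff_of_subset hsub, Finset.card_range,
    Nat.cast_sub (by simpa using Finset.card_le_card hsub), sub_div]
  push_cast
  rw [div_self (by positivity)]
  refine sub_le_sub_left ?_ 1
  rw [div_le_div_iff₀ (by positivity) (by positivity), one_mul]
  exact_mod_cast hbad

end Probability

/-! ### The space bound -/

section Space

variable {n : ℕ}

lemma le_mul_log_of_two_pow_le {k m d b : ℕ} (hn : 1 ≤ n) (hm : m ≤ 2 ^ b * (n + 1) ^ d)
    (hk : 2 ^ k ≤ m) : (k : ℝ) ≤ 2 * (b + d) * Real.log (n + 1) := by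
  have hlog2 : (1 / 2 : ℝ) < Real.log 2 := by linarith [Real.log_two_gt_d9]
  have hn' : (1 : ℝ) ≤ n := by exact_mod_cast hn
  have hlog : Real.log 2 ≤ Real.log (n + 1) := Real.log_le_log two_pos (by linarith)
  have h1 : (2 : ℝ) ^ k ≤ 2 ^ b * (n + 1) ^ d := by exact_mod_cast hk.trans hm
  have h2 := Real.log_le_log (by positivity) h1
  rw [Real.log_mul (by positivity) (by positivity), Real.log_pow, Real.log_pow, Real.log_pow] at h2
  have h3 : (k : ℝ) * (1 / 2) ≤ k * Real.log 2 :=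
    mul_le_mul_of_nonneg_left hlog2.le (Nat.cast_nonneg k)
  have h4 : (b : ℝ) * Real.log 2 ≤ b * Real.log (n + 1) :=
    mul_le_mul_of_nonneg_left hlog (Nat.cast_nonneg b)
  linarith

lemma modulusLog_add_one_le (hn : 1 ≤ n) :
    ((modulusLog n + 1 : ℕ) : ℝ) ≤ 20 * Real.log (n + 1) := by
  have h4 : n ^ 4 ≤ (n + 1) ^ 4 := Nat.pow_le_pow_left (Nat.le_succ n) 4
  have h1 : 1 ≤ n ^ 4 := Nat.one_le_pow _ _ hn
  have hlt : 2 ^ (modulusLog n - 1) < 16 * n ^ 4 :=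
    Nat.pow_pred_clog_lt_self one_lt_two (by omega)
  have h2 : 2 ^ (modulusLog n + 1) ≤ 2 ^ 6 * (n + 1) ^ 4 := by
    rcases Nat.eq_zero_or_pos (modulusLog n) with h0 | h0
    · rw [h0]; omega
    · obtain ⟨i, hi⟩ : ∃ i, modulusLog n = i + 1 := ⟨modulusLog n - 1, by omega⟩
      rw [hi] at hlt ⊢
      simp only [Nat.add_sub_cancel] at hlt
      rw [pow_succ, pow_succ]
      omega
  refine (le_mul_log_of_two_pow_le hn le_rfl h2).trans_eq ?_
  norm_num

lemma size_le_mul_log (hn : 1 ≤ n) (a : ℕ) :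
    ((n ^ (a + 6) + 1).size : ℝ) ≤ 2 * (a + 7) * Real.log (n + 1) := by
  obtain ⟨i, hi⟩ : ∃ i, (n ^ (a + 6) + 1).size = i + 1 :=
    Nat.exists_eq_succ_of_ne_zero (Nat.size_pos.2 (Nat.succ_pos _)).ne'
  have h1 : 2 ^ i ≤ n ^ (a + 6) + 1 := Nat.lt_size.1 (by omega)
  have h2 : n ^ (a + 6) + 1 ≤ (n + 1) ^ (a + 6) := by
    have := Nat.pow_lt_pow_left (Nat.lt_succ_self n) (show a + 6 ≠ 0 by omega)
    exact this
  have h3 : 2 ^ (i + 1) ≤ 2 ^ 1 * (n + 1) ^ (a + 6) := by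
    rw [pow_succ]
    omega
  rw [hi]
  refine (le_mul_log_of_two_pow_le hn le_rfl h3).trans_eq ?_
  push_cast
  ring

lemma registerSize_le (hn : 1 ≤ n) (c a : ℕ) : ((32 * (5 + registerSize n c a) : ℕ) : ℝ) ≤
    32 * (48 + (40 + 6 * (a + 7)) * (38400 * (1 + c))) * n * Real.log (n + 1) ^ 3 := by
  have hlog2 : (1 / 2 : ℝ) < Real.log 2 := by linarith [Real.log_two_gt_d9]
  have hn' : (1 : ℝ) ≤ n := by exact_mod_cast hn
  have hlog : Real.log 2 ≤ Real.log (n + 1) := Real.log_le_log two_pos (by linarith)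
  have ht := modulusLog_add_one_le hn
  have hw := size_le_mul_log hn a
  set lg := Real.log (n + 1) with hlg
  have hlg0 : 1 / 2 ≤ lg := by linarith
  have hlg3 : 1 ≤ 8 * lg ^ 3 := by
    have := pow_le_pow_left₀ (by norm_num) hlg0 3
    norm_num at this
    linarith
  have hK : (samplerCount n c : ℝ) ≤ 38400 * (1 + c) * n * lg ^ 2 := by
    have h1 : (samplerCount n c : ℝ) =
        96 * (n + c) * ((modulusLog n + 1 : ℕ) : ℝ) ^ 2 := by
      simp only [samplerCount, samplersPerLevel]
      push_cast
      ring
    have h2 : ((modulusLog n + 1 : ℕ) : ℝ) ^ 2 ≤ 400 * lg ^ 2 :=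
      (pow_le_pow_left₀ (Nat.cast_nonneg _) ht 2).trans_eq (by ring)
    have h3 : (n : ℝ) + c ≤ (1 + c) * n := by
      nlinarith [mul_le_mul_of_nonneg_left hn' (Nat.cast_nonneg (α := ℝ) c)]
    rw [h1]
    calc 96 * ((n : ℝ) + c) * ((modulusLog n + 1 : ℕ) : ℝ) ^ 2
        ≤ 96 * ((1 + c) * n) * (400 * lg ^ 2) := by gcongr
      _ = _ := by ring
  have hfac : (2 * modulusLog n + 3 * ((n ^ (a + 6) + 1).size : ℝ)) ≤
      (40 + 6 * (a + 7)) * lg := by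
    push_cast at ht
    linarith
  have hprod : (2 * modulusLog n + 3 * ((n ^ (a + 6) + 1).size : ℝ)) * samplerCount n c ≤
      ((40 + 6 * (a + 7)) * lg) * (38400 * (1 + c) * n * lg ^ 2) := by gcongr
  have h6 : (6 : ℝ) ≤ 48 * n * lg ^ 3 := by
    nlinarith [mul_le_mul_of_nonneg_left hn' (show (0 : ℝ) ≤ lg ^ 3 by positivity)]
  rw [registerSize]
  push_cast
  nlinarith [hprod, h6]

end Space

/-- The algorithm is correct for insertion-deletion streams. -/
lemma existsSemiStreamingAlgorithm_insertionDeletion (c a : ℕ) :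
    ExistsSemiStreamingAlgorithm c fun n G σ => IsInsertionDeletionStream (n ^ a) G σ := by
  refine ⟨longPathProgram c a, 32 * (48 + (40 + 6 * (a + 7)) * (38400 * (1 + c))), 3, ?_⟩
  intro n hn G σ hσ
  have hrun : ∀ ω, ∃ s, Exec (longPathProgram c a) (initial σ ω) s ∧
      Fits (registerSize n c a) s ∧ ∃ A p, IsRunResult c a σ ω A p s.output := by
    intro ω
    refine ensures_longPathProgram hn ω hσ.2.1 ?_
    have hlt : n < 2 ^ registerSize n c a := by
      have h1 := le_samplerCount c hn
      have h2 : samplerCount n c ≤ registerSize n c a := by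
        rw [registerSize]
        refine (Nat.le_mul_of_pos_left _ ?_).trans (Nat.le_succ _)
        have := Nat.size_pos.2 (Nat.succ_pos (n ^ (a + 6)))
        simp only [Nat.succ_eq_add_one] at this
        omega
      exact lt_of_le_of_lt (by omega) (Nat.lt_two_pow_self (n := registerSize n c a))
    have h1 : ∀ r, (Finsupp.single 0 n : Mem) r < 2 ^ registerSize n c a := by
      intro r
      rw [Finsupp.single_apply]
      split_ifs
      · exact hlt
      · positivity
    have h2 : ∀ r, 32 ≤ r → (Finsupp.single 0 n : Mem) r = 0 := fun r hr => by
      rw [Finsupp.single_apply, if_neg (by omega)]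
    exact ⟨h1, h2, bits_le h1 h2⟩
  refine ⟨fun ω => ?_, le_outputProb c hn hσ fun ω => ?_⟩
  · obtain ⟨s, hex, hfit, -⟩ := hrun ω
    exact ⟨s, hex, (Nat.cast_le.2 hfit.peak_le).trans (registerSize_le hn c a)⟩
  · obtain ⟨s, hex, -, h⟩ := hrun ω
    exact ⟨s, hex, h⟩

/-- The multiplicities of an insertion-only stream are at most `1`. -/
lemma IsInsertionOnlyStream.isInsertionDeletionStream {n : ℕ} {G : SimpleGraph (Fin n)}
    {σ : List (Update n)} (h : IsInsertionOnlyStream G σ) : IsInsertionDeletionStream 1 G σ := by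
  obtain ⟨hins, hnd, hmem⟩ := h
  have hmult : ∀ τ, τ <+: σ → ∀ e, edgeMultiplicity τ e = (τ.map Update.edge).count e := by
    intro τ hτ e
    have h1 : (τ.countP fun t => t.ins = false ∧ t.edge = e) = 0 := by
      rw [List.countP_eq_zero]
      intro t ht
      simp [hins t (hτ.subset ht)]
    have h2 : (τ.countP fun t => t.ins = true ∧ t.edge = e) = (τ.map Update.edge).count e := by
      rw [List.count, List.countP_map]
      refine List.countP_congr fun t ht => ?_
      simp [hins t (hτ.subset ht)]
    rw [edgeMultiplicity, h1, h2]
    simp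
  refine ⟨fun t ht huv => ?_, fun τ hτ e => ?_, fun e => ?_⟩
  · have : t.edge ∈ G.edgeSet := (hmem _).1 (List.mem_map_of_mem ht)
    rw [Update.edge, SimpleGraph.mem_edgeSet] at this
    exact this.ne huv
  · rw [hmult τ hτ]
    have hnd' : (τ.map Update.edge).Nodup := hnd.sublist (hτ.sublist.map _)
    have := List.nodup_iff_count_le_one.1 hnd' e
    constructor <;> omega
  · rw [hmult σ (List.prefix_refl σ), ← hmem e, ← List.count_pos_iff]
    omega

end LongPathStreaming

theorem theorem1 :
    (∀ c : ℕ, LongPathStreaming.ExistsSemiStreamingAlgorithm c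
      fun _ G σ => LongPathStreaming.IsInsertionOnlyStream G σ) ∧
    (∀ c a : ℕ, LongPathStreaming.ExistsSemiStreamingAlgorithm c
      fun n G σ => LongPathStreaming.IsInsertionDeletionStream (n ^ a) G σ) := by
  refine ⟨fun c => ?_, LongPathStreaming.existsSemiStreamingAlgorithm_insertionDeletion⟩
  obtain ⟨P, C, k, h⟩ := LongPathStreaming.existsSemiStreamingAlgorithm_insertionDeletion c 0
  refine ⟨P, C, k, fun n hn G σ hσ => h n hn G σ ?_⟩
  beta_reduce
  rw [pow_zero]
  exact hσ.isInsertionDeletionStream
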